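/- All monoids are commutative, cancellative and unitary, and are written additively. Let $S$ be a monoid with quotient group $G$. For a subset $P\subseteq S$ and a domain $D$, let $D[P]\subseteq D[S]$ be the set of all elements of the monoid algebra $D[S]$ all of whose exponents lie in $P$. The monoid $S$ is torsion-free if $ns=nt$ implies $s=t$ for all $s,t\in S$ and $n\ge 1$; in this case $D[S]$ and $D[G]$ are domains. Let $\mathfrak X(D)$ denote the set of height-one prime ideals of a domain $D$, and let $\mathfrak X(S)$ denote the set of minimal non-empty prime ideals of $S$ (also called the height-one primes of $S$). The domain $D$ is *weakly Krull* if $D=\bigcap_{P\in\mathfrak X(D)}D_P$ inside the quotient field of $D$ and every non-zero non-unit of $D$ lies in only finitely many $P\in\mathfrak X(D)$. The monoid $S$ is *weakly Krull* if $S=\bigcap_{P\in\mathfrak X(S)}S_P$ inside $G$, where $S_P=\{a-b\mid a\in S,\ b\in S\setminus P\}$, and every non-unit of $S$ lies in only finitely many $P\in\mathfrak X(S)$. (An empty intersection is the whole quotient field, respectively the whole quotient group.) If $S$ is torsion-free, then $S$ is *$D$-UMT* if $$\mathfrak X(D[S])=\{D[P]\mid P\in\mathfrak X(S)\}\cup\{Q\cap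 D[S]\mid Q\in\mathfrak X(D[G])\}.$$ For an ideal $I$ of a domain $R$ with quotient field $F$, put $I^{-1}=\{x\in F\mid xI\subseteq R\}$ and $I_v=(I^{-1})^{-1}$ if $I\neq 0$, put $0_v=0$, and let $I_t=\bigcup J_v$, where $J$ runs over the finitely generated ideals contained in $I$. An ideal $I$ is a *$t$-ideal* if $I_t=I$; a *maximal $t$-ideal* is an ideal that is maximal among the proper $t$-ideals. **Proposition 2.6.** Let $K$ be a field and let $S$ be a torsion-free monoid whose quotient group $G$ satisfies the ascending chain condition on cyclic subgroups. Then $K[S]$ is weakly Krull if and only if $S$ is weakly Krull and $K$-UMT. Moreover, if these equivalent conditions hold, then $K[P]$ is a maximal $t$-ideal of $K[S]$ for every $P\in\mathfrak X(S)$. -/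

import Mathlib

open scoped AddMonoidAlgebra nonZeroDivisors
open Algebra (GrothendieckAddGroup)

/-! ### Torsion-free monoids: their monoid algebras over domains are domains -/

/-- A torsion-free cancellative commutative monoid has unique sums. Together with Mathlib's
instances this makes `D[S]` a domain whenever `D` is a domain. -/
instance (priority := low) TorsionFreeMonoid.twoUniqueSums (S : Type*) [AddCancelCommMonoid S]
    [IsAddTorsionFree S] : TwoUniqueSums S where
  uniqueAdd_of_one_lt_card {A B} hAB := by
    classical
    let H : AddSubmonoid S := AddSubmonoid.closure (A ∪ B : Finset S)
    have : AddMonoid.FG H := (AddMonoid.fg_iff_addSubmonoid_fg H).2 ⟨A ∪ B, rfl⟩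
    have : IsAddTorsionFree H :=
      ⟨fun n hn a b h => Subtype.ext (IsAddTorsionFree.nsmul_right_injective hn
        (by simpa using congrArg (Subtype.val : H → S) h))⟩
    let _ : AddCancelCommMonoid H := { (inferInstance : AddCommMonoid H) with
      add_left_cancel := fun a b c h => Subtype.ext (add_left_cancel (a := (a : S))
        (congrArg (Subtype.val : H → S) h)) }
    have : TwoUniqueSums H := inferInstance
    have hA : ∀ a ∈ A, a ∈ H := fun a ha => AddSubmonoid.subset_closure (by simp [ha])
    have hB : ∀ b ∈ B, b ∈ H := fun b hb => AddSubmonoid.subset_closure (by simp [hb])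
    have hcard : 1 < (A.subtype (· ∈ H)).card * (B.subtype (· ∈ H)).card := by
      rw [Finset.card_subtype, Finset.card_subtype, Finset.filter_true_of_mem hA,
        Finset.filter_true_of_mem hB]
      exact hAB
    obtain ⟨p, hp, q, hq, hne, hup, huq⟩ := TwoUniqueSums.uniqueAdd_of_one_lt_card hcard
    have key : ∀ x y : H, UniqueAdd (A.subtype (· ∈ H)) (B.subtype (· ∈ H)) x y →
        UniqueAdd A B (x : S) (y : S) := fun x y h a b ha hb hab => by
      have := h (a := ⟨a, hA a ha⟩) (b := ⟨b, hB b hb⟩) (by simpa using ha) (by simpa using hb)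
        (Subtype.ext hab)
      exact ⟨congrArg Subtype.val this.1, congrArg Subtype.val this.2⟩
    refine ⟨((p.1 : S), (p.2 : S)), by simpa using hp, ((q.1 : S), (q.2 : S)), by simpa using hq, fun h => hne ?_,
      key _ _ hup, key _ _ huq⟩
    simp only [Prod.mk.injEq] at h
    exact Prod.ext (Subtype.ext h.1) (Subtype.ext h.2)

/-- The ascending chain condition on cyclic subgroups. -/
def SatisfiesACCOnCyclicSubgroups (G : Type*) [AddCommGroup G] : Prop :=
  ∀ C : ℕ →o AddSubgroup G, (∀ n, ∃ g : G, C n = AddSubgroup.zmultiples g) →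
    ∃ n, ∀ m, n ≤ m → C n = C m

/-! ### Weakly Krull domains -/

/-- The height-one spectrum `𝔛(R)` of a domain: the set of prime ideals of height one. -/
def heightOneSpectrum (R : Type*) [CommRing R] : Set (Ideal R) :=
  {P | P.IsPrime ∧ P.height = 1}

/-- A domain `R` is weakly Krull if `R = ⋂ R_P` inside its quotient field, where `P` runs over the
height-one primes, and every non-zero non-unit lies in only finitely many height-one primes.
(The empty intersection is the whole quotient field.) -/
structure IsWeaklyKrullDomain (R : Type*) [CommRing R] [IsDomain R] : Prop where
  iInf_localization_eq_bot :
    ⨅ P : {P : PrimeSpectrum R // P.asIdeal ∈ heightOneSpectrum R},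
      Localization.subalgebra.ofField (FractionRing R) P.1.asIdeal.primeCompl
        P.1.asIdeal.primeCompl_le_nonZeroDivisors = ⊥
  finite_character : ∀ x : R, x ≠ 0 → ¬ IsUnit x → {P ∈ heightOneSpectrum R | x ∈ P}.Finite

/-! ### Weakly Krull monoids -/

/-- A (possibly empty) ideal `P` of a monoid `S` is prime if `P ≠ S` and `a + b ∈ P` implies
`a ∈ P` or `b ∈ P`. -/
structure IsPrimeMonoidIdeal {S : Type*} [AddCommMonoid S] (P : AddSemigroupIdeal S) : Prop where
  ne_univ : (P : Set S) ≠ Set.univ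
  mem_or_mem : ∀ a b : S, a + b ∈ P → a ∈ P ∨ b ∈ P

/-- `𝔛(S)`: the set of minimal non-empty prime ideals of the monoid `S`. -/
def monoidHeightOneSpectrum (S : Type*) [AddCommMonoid S] : Set (AddSemigroupIdeal S) :=
  {P | Minimal (fun Q : AddSemigroupIdeal S => IsPrimeMonoidIdeal Q ∧ (Q : Set S).Nonempty) P}

/-- The localization `S_P = {a - b | a ∈ S, b ∈ S \ P}` as a subset of the quotient group. -/
def monoidLocalization {S : Type*} [AddCommMonoid S] (P : AddSemigroupIdeal S) :
    Set (GrothendieckAddGroup S) :=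
  {g | ∃ a b : S, b ∉ P ∧ g = GrothendieckAddGroup.of a - GrothendieckAddGroup.of b}

/-- A monoid `S` is weakly Krull if `S = ⋂ S_P` inside its quotient group, where `P` runs over the
minimal non-empty primes, and every non-unit lies in only finitely many of these.
(The empty intersection is the whole quotient group.) -/
structure IsWeaklyKrullMonoid (S : Type*) [AddCancelCommMonoid S] : Prop where
  iInter_localization_eq_range :
    ⋂ P ∈ monoidHeightOneSpectrum S, monoidLocalization P =
      Set.range (GrothendieckAddGroup.of : S →+ GrothendieckAddGroup S)
  finite_character : ∀ a : S, ¬ IsAddUnit a → {P ∈ monoidHeightOneSpectrum S | a ∈ P}.Finite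

/-! ### The UMT property -/

/-- `D[P]`, for an ideal `P` of `S`: the elements of `D[S]` all of whose exponents lie in `P`,
as an ideal of `D[S]`. -/
def monoidAlgebraIdeal (D : Type*) [CommRing D] {S : Type*} [AddCommMonoid S]
    (P : AddSemigroupIdeal S) : Ideal D[S] where
  carrier := {f | ∀ s ∈ f.coeff.support, s ∈ P}
  add_mem' {f g} hf hg s hs := by
    classical
    exact (Finset.mem_union.1 (Finsupp.support_add hs)).elim (hf s) (hg s)
  zero_mem' := by simp
  smul_mem' f g hg s hs := by
    classical
    obtain ⟨a, -, b, hb, rfl⟩ := Finset.mem_add.1 (AddMonoidAlgebra.support_coeff_mul_subset f g hs)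
    exact AddSemigroupIdeal.add_mem P a (hg b hb)

/-- `S` is `D`-UMT if `𝔛(D[S]) = {D[P] | P ∈ 𝔛(S)} ∪ {Q ∩ D[S] | Q ∈ 𝔛(D[G])}`, where `G` is the
quotient group of `S`. -/
def IsUMTOver (D S : Type*) [CommRing D] [IsDomain D] [AddCancelCommMonoid S]
    [IsAddTorsionFree S] : Prop :=
  heightOneSpectrum D[S] =
    {I | ∃ P ∈ monoidHeightOneSpectrum S, I = monoidAlgebraIdeal D P} ∪
    {I | ∃ Q ∈ heightOneSpectrum D[GrothendieckAddGroup S],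
      I = Q.comap (AddMonoidAlgebra.mapDomainRingHom D
        (GrothendieckAddGroup.of : S →+ GrothendieckAddGroup S))}

/-! ### `t`-ideals of domains -/

/-- `I_t = ⋃ J_v`, where `J` runs over the finitely generated ideals contained in `I`, and
`J_v = (J⁻¹)⁻¹` with `J⁻¹ = {x ∈ K | xJ ⊆ R}` for `J ≠ 0`, and `0_v = 0`. -/
def tClosure {R : Type*} [CommRing R] [IsDomain R] (I : Ideal R) : Set (FractionRing R) :=
  {x | ∃ J : Ideal R, J.FG ∧ J ≤ I ∧ x ∈ ((J : FractionalIdeal R⁰ (FractionRing R))⁻¹)⁻¹}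

/-- `I` is a `t`-ideal if `I_t = I`. -/
def IsTIdeal {R : Type*} [CommRing R] [IsDomain R] (I : Ideal R) : Prop :=
  tClosure I = algebraMap R (FractionRing R) '' I

/-- `I` is a maximal `t`-ideal if it is maximal among the proper `t`-ideals. -/
def IsMaximalTIdeal {R : Type*} [CommRing R] [IsDomain R] (I : Ideal R) : Prop :=
  Maximal (fun J : Ideal R => J ≠ ⊤ ∧ IsTIdeal J) I

/-! ### Height-one primes of domains -/

section Domain

variable {R : Type*} [CommRing R] [IsDomain R]

/-! A height-one prime of `K[S]` either contains a monomial, and then it is `K[P]` with `P` minimal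
(`exists_eq_monoidAlgebraIdeal`), or it contains none, and then it survives in `K[G]`, the
localization at the monomials, and is contracted from there. Contractions of height-one primes of
`K[G]` always have height one, so UMT amounts to each `K[P]`, `P ∈ 𝔛(S)`, having height one.

In a weakly Krull domain, a prime containing a nonzero `x` contains a height-one prime through `x`.
For `x` a monomial in `K[P]`, that prime is some `K[P']` with `P' ⊆ P`, so `P' = P` and UMT follows.
The weakly Krull property of `S` is then that of `K[S]` tested on monomials.

For the converse, `K[G]` is factorial. Suppose `a / b` lies in every localization of `K[S]` at a
height-one prime. The contracted primes give `a = b c` in `K[G]`; each prime `K[P]` forces the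
exponents of `c` into `S_P` (`mem_monoidLocalization_of_mul_eq`); since `S = ⋂ S_P`, `c ∈ K[S]`.
Finite character comes from that of `S` and from the finitely many prime factors in `K[G]`.

Factoriality of `K[G]` has two halves. Irreducibles are prime because any one divisibility relation
lives in a Laurent polynomial ring over a finitely generated subgroup. Factorizations terminate
because widths of edges of Newton polytopes are additive, and the chain condition on cyclic
subgroups keeps the positive edge widths of the divisors of a fixed element away from zero
(`exists_length_function`).

The assertion on `t`-ideals holds for every height-one prime of a weakly Krull domain. -/

theorem mem_heightOneSpectrum_iff {P : Ideal R} :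
    P ∈ heightOneSpectrum R ↔
      P.IsPrime ∧ P ≠ ⊥ ∧ ∀ Q : Ideal R, Q.IsPrime → Q ≠ ⊥ → Q ≤ P → Q = P := by
  constructor
  · rintro ⟨hP, h⟩
    refine ⟨hP, Ideal.ne_bot_of_height_eq_one h, fun Q hQ hQ0 hQP => ?_⟩
    by_contra hne
    have := Ideal.height_add_one_le_of_lt_of_isPrime (lt_of_le_of_ne hQP hne)
    rw [h] at this
    have h0 : Q.height = 0 := by
      generalize Q.height = x at this
      cases x with
      | top => simp at this
      | coe x => norm_cast at this ⊢; omega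
    exact hQ0 (Ideal.height_eq_zero_iff_eq_bot.1 h0)
  · rintro ⟨hP, h0, h⟩
    refine ⟨hP, le_antisymm ?_ ?_⟩
    · have := (Ideal.height_le_iff (p := P) (n := 1)).2 fun Q hQ hlt => by
        have hQ0 : Q = ⊥ := by
          by_contra hQ0
          exact hlt.ne (h Q hQ hQ0 hlt.le)
        subst hQ0
        simp
      simpa using this
    · rw [Order.one_le_iff_ne_zero]
      exact fun hh => h0 (Ideal.height_eq_zero_iff_eq_bot.1 hh)

/-- Clearing denominators: `a / b ∈ R_Q` means `b ∣ a * s` for some `s ∉ Q`. In this form the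
intersection condition is a local test for divisibility inside `R`. Without height-one primes the
test is vacuous and `R` is a field. -/
theorem iInf_localization_eq_bot_iff :
    (⨅ P : {P : PrimeSpectrum R // P.asIdeal ∈ heightOneSpectrum R},
      Localization.subalgebra.ofField (FractionRing R) P.1.asIdeal.primeCompl
        P.1.asIdeal.primeCompl_le_nonZeroDivisors = ⊥) ↔
    ∀ a b : R, b ≠ 0 → (∀ Q ∈ heightOneSpectrum R, ∃ s, s ∉ Q ∧ b ∣ a * s) → b ∣ a := by
  have hinj : Function.Injective (algebraMap R (FractionRing R)) :=
    IsFractionRing.injective R (FractionRing R)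
  have hne : ∀ {b : R}, b ≠ 0 → algebraMap R (FractionRing R) b ≠ 0 := fun hb =>
    (map_ne_zero_iff _ hinj).2 hb
  have key : ∀ (P : {P : PrimeSpectrum R // P.asIdeal ∈ heightOneSpectrum R}) (a b : R), b ≠ 0 →
      (algebraMap R (FractionRing R) a / algebraMap R (FractionRing R) b ∈
        Localization.subalgebra.ofField (FractionRing R) P.1.asIdeal.primeCompl
        P.1.asIdeal.primeCompl_le_nonZeroDivisors ↔ ∃ s, s ∉ P.1.asIdeal ∧ b ∣ a * s) := by
    intro P a b hb
    constructor
    · rintro ⟨c, s, hs, h⟩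
      have hs0 : s ≠ 0 := fun h => hs (h ▸ P.1.asIdeal.zero_mem)
      refine ⟨s, hs, c, hinj ?_⟩
      have h1 := hne hb
      have h2 := hne hs0
      rw [map_mul, map_mul]
      field_simp at h
      linear_combination h
    · rintro ⟨s, hs, c, h⟩
      have hs0 : s ≠ 0 := fun h => hs (h ▸ P.1.asIdeal.zero_mem)
      refine ⟨c, s, hs, ?_⟩
      have h1 := hne hb
      have h2 := hne hs0
      have h3 := congrArg (algebraMap R (FractionRing R)) h
      rw [map_mul, map_mul] at h3
      field_simp
      linear_combination h3
  constructor
  · intro h a b hb hQ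
    have hmem : algebraMap R (FractionRing R) a / algebraMap R (FractionRing R) b ∈
        (⊥ : Subalgebra R (FractionRing R)) := by
      rw [← h, Algebra.mem_iInf]
      exact fun P => (key P a b hb).2 (hQ _ P.2)
    obtain ⟨c, hc⟩ := Algebra.mem_bot.1 hmem
    refine ⟨c, hinj ?_⟩
    rw [map_mul, hc, mul_div_cancel₀ _ (hne hb)]
  · intro h
    rw [eq_bot_iff]
    intro x hx
    obtain ⟨a, b, hb, rfl⟩ := IsFractionRing.div_surjective (A := R) x
    have hb : b ≠ 0 := nonZeroDivisors.ne_zero hb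
    rw [Algebra.mem_iInf] at hx
    obtain ⟨c, rfl⟩ := h a b hb fun Q hQ => (key ⟨⟨Q, hQ.1⟩, hQ⟩ a b hb).1 (hx _)
    rw [Algebra.mem_bot]
    exact ⟨c, by rw [map_mul, mul_div_cancel_left₀ _ (hne hb)]⟩

/-- In `R_Q` the only nonzero prime is the maximal ideal, so it is the radical of every nonzero
proper principal ideal. Concretely, a prime over `x` that avoids both the powers of `y` and the
complement of `Q` would have to equal `Q`, which contains `y`. -/
theorem exists_dvd_pow_mul_of_mem_heightOneSpectrum {Q : Ideal R} (hQ : Q ∈ heightOneSpectrum R)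
    {x y : R} (hx : x ≠ 0) (hy : y ∈ Q) : ∃ (n : ℕ) (t : R), t ∉ Q ∧ x ∣ y ^ n * t := by
  obtain ⟨hP, -, hmin⟩ := mem_heightOneSpectrum_iff.1 hQ
  by_contra! hcon
  have hdisj : Disjoint (Ideal.span {x} : Set R)
      (Submonoid.powers y ⊔ Q.primeCompl : Submonoid R) := by
    rw [Set.disjoint_left]
    intro z hz hz'
    obtain ⟨_, ⟨n, rfl⟩, t, ht, rfl⟩ := Submonoid.mem_sup.1 hz'
    exact hcon n t ht (Ideal.mem_span_singleton.1 hz)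
  obtain ⟨p, hp, hxp, hd⟩ := Ideal.exists_le_prime_disjoint _ _ hdisj
  rw [Set.disjoint_left] at hd
  have hpQ : p ≤ Q := fun z hz => by
    by_contra hzQ
    exact hd hz (Submonoid.mem_sup_right (S := Submonoid.powers y) (show z ∈ Q.primeCompl from hzQ))
  have hp0 : p ≠ ⊥ := fun h => hx (by
    have := hxp (Ideal.mem_span_singleton_self x)
    rwa [h, Ideal.mem_bot] at this)
  have := hmin p hp hp0 hpQ
  exact hd (this ▸ hy) (Submonoid.mem_sup_left (Submonoid.mem_powers y))

/-- A finitely generated ideal inside a height-one prime `Q` is multiplied into `a R_Q` by some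
element outside `a R_Q`. -/
theorem exists_forall_dvd_mul_of_mem_heightOneSpectrum {Q : Ideal R} (hQ : Q ∈ heightOneSpectrum R)
    {a : R} (ha : a ≠ 0) (haQ : a ∈ Q) (s : Finset R) (hs : ∀ j ∈ s, j ∈ Q) :
    ∃ x t : R, t ∉ Q ∧ (∀ u, u ∉ Q → ¬ a ∣ x * u) ∧ ∀ j ∈ s, a ∣ x * j * t := by
  classical
  have hP : Q.IsPrime := hQ.1
  induction s using Finset.induction_on with
  | empty => exact ⟨1, 1, (Ideal.ne_top_iff_one Q).1 hP.ne_top,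
      fun u hu h => hu (by simpa using Q.mem_of_dvd h haQ), by simp⟩
  | insert j s _ ih =>
    obtain ⟨x, t, ht, hx, hxs⟩ := ih fun i hi => hs i (Finset.mem_insert_of_mem hi)
    -- For the least `n` with `x * j ^ n ∈ a R_Q`, the element `x * j ^ (n - 1)` is still outside `a
    -- R_Q` and is multiplied into it by `j`. Here `n ≠ 0` because `x ∉ a R_Q`.
    have hex : ∃ n : ℕ, ∃ u, u ∉ Q ∧ a ∣ x * j ^ n * u := by
      obtain ⟨n, u, hu, h⟩ := exists_dvd_pow_mul_of_mem_heightOneSpectrum hQ ha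
        (hs j (Finset.mem_insert_self _ _))
      exact ⟨n, u, hu, by rw [mul_assoc]; exact h.mul_left x⟩
    obtain ⟨u, hu, h⟩ := Nat.find_spec hex
    have hpos : Nat.find hex ≠ 0 := fun h0 => hx u hu (by simpa [h0] using h)
    obtain ⟨m, hm⟩ := Nat.exists_eq_succ_of_ne_zero hpos
    refine ⟨x * j ^ m, t * u, fun h => (hP.mem_or_mem h).elim ht hu, fun v hv hdvd =>
      Nat.find_min hex (m := m) (by omega) ⟨v, hv, hdvd⟩, fun i hi => ?_⟩
    rcases Finset.mem_insert.1 hi with rfl | hi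
    · rw [hm, pow_succ] at h
      exact (h.mul_right t).trans (by apply dvd_of_eq; ring)
    · exact ((hxs i hi).mul_right (j ^ m * u)).trans (by apply dvd_of_eq; ring)

/-! ### Divisorial closures and `t`-ideals -/

theorem mem_inv_inv_iff {J : Ideal R} (hJ : J ≠ ⊥) {z : FractionRing R} :
    z ∈ ((J : FractionalIdeal R⁰ (FractionRing R))⁻¹)⁻¹ ↔
      ∀ y : FractionRing R, (∀ j ∈ J, ∃ r : R, algebraMap R _ r = y * algebraMap R _ j) →
        ∃ r : R, algebraMap R _ r = z * y := by
  have hJ' : (J : FractionalIdeal R⁰ (FractionRing R)) ≠ 0 :=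
    FractionalIdeal.coeIdeal_ne_zero.2 hJ
  have h1 : ∀ y : FractionRing R, y ∈ (J : FractionalIdeal R⁰ (FractionRing R))⁻¹ ↔
      ∀ j ∈ J, ∃ r : R, algebraMap R _ r = y * algebraMap R _ j := by
    intro y
    rw [FractionalIdeal.mem_inv_iff hJ']
    simp only [FractionalIdeal.mem_coeIdeal, FractionalIdeal.mem_one_iff]
    constructor
    · exact fun h j hj => h _ ⟨j, hj, rfl⟩
    · rintro h _ ⟨j, hj, rfl⟩
      exact h j hj
  have h0 : (J : FractionalIdeal R⁰ (FractionRing R))⁻¹ ≠ 0 := by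
    intro h
    have : (1 : FractionRing R) ∈ (J : FractionalIdeal R⁰ (FractionRing R))⁻¹ :=
      (h1 1).2 fun j _ => ⟨j, by simp⟩
    rw [h, FractionalIdeal.mem_zero_iff] at this
    exact one_ne_zero this
  rw [FractionalIdeal.mem_inv_iff h0]
  simp only [FractionalIdeal.mem_one_iff, h1]

theorem algebraMap_mem_tClosure {I : Ideal R} {x : R} (hx : x ∈ I) :
    algebraMap R (FractionRing R) x ∈ tClosure I := by
  refine ⟨Ideal.span {x}, ⟨{x}, by simp⟩, by simpa [Ideal.span_le] using hx, ?_⟩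
  by_cases h0 : x = 0
  · subst h0
    simp [FractionalIdeal.inv_zero']
  · rw [mem_inv_inv_iff (by simpa using h0)]
    intro y hy
    obtain ⟨r, hr⟩ := hy x (Ideal.mem_span_singleton_self x)
    exact ⟨r, by rw [hr, mul_comm]⟩

/-- For a nonzero finitely generated `J ⊆ Q`, the preceding construction gives `x * t / a ∈ J⁻¹`
with `x ∉ a R_Q` and `t ∉ Q`. An `r ∈ J_v` outside `Q` would give `a ∣ x * (t * r)` with `t * r ∉
Q`, a contradiction. -/
theorem isTIdeal_of_mem_heightOneSpectrum {Q : Ideal R} (hQ : Q ∈ heightOneSpectrum R) :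
    IsTIdeal Q := by
  have hP : Q.IsPrime := hQ.1
  have hinj : Function.Injective (algebraMap R (FractionRing R)) :=
    IsFractionRing.injective R (FractionRing R)
  refine Set.Subset.antisymm ?_ ?_
  · rintro z ⟨J, ⟨s, rfl⟩, hJQ, hz⟩
    have hsQ : ∀ j ∈ s, j ∈ Q := fun j hj => hJQ (Ideal.subset_span hj)
    by_cases hJ : Ideal.span (s : Set R) = ⊥
    · rw [hJ] at hz
      simp only [FractionalIdeal.coeIdeal_bot, FractionalIdeal.inv_zero',
        FractionalIdeal.mem_zero_iff] at hz
      exact ⟨0, Q.zero_mem, by simp [hz]⟩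
    · obtain ⟨a, haJ, ha⟩ := Submodule.exists_mem_ne_zero_of_ne_bot hJ
      obtain ⟨x, t, ht, hx, hxs⟩ := exists_forall_dvd_mul_of_mem_heightOneSpectrum hQ ha
        (hJQ haJ) s hsQ
      have ha' : algebraMap R (FractionRing R) a ≠ 0 := (map_ne_zero_iff _ hinj).2 ha
      rw [mem_inv_inv_iff hJ] at hz
      obtain ⟨r, hr⟩ := hz 1 fun j _ => ⟨j, by simp⟩
      rw [mul_one] at hr
      refine ⟨r, ?_, hr⟩
      by_contra hrQ
      have hall : ∀ j ∈ Ideal.span (s : Set R), a ∣ x * t * j := by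
        intro j hj
        induction hj using Submodule.span_induction with
        | mem j hj => exact (hxs j hj).trans (by apply dvd_of_eq; ring)
        | zero => simp
        | add i j _ _ hi hj => rw [mul_add]; exact dvd_add hi hj
        | smul c j _ hj => rw [smul_eq_mul, mul_left_comm]; exact hj.mul_left c
      obtain ⟨r', hr'⟩ := hz (algebraMap R _ (x * t) / algebraMap R _ a) fun j hj => by
        obtain ⟨c, hc⟩ := hall j hj
        refine ⟨c, ?_⟩
        rw [div_mul_eq_mul_div, ← map_mul, hc, map_mul, mul_div_cancel_left₀ _ ha']
      refine hx (t * r) (fun h => (hP.mem_or_mem h).elim ht hrQ) ⟨r', hinj ?_⟩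
      rw [map_mul _ a r', hr', ← hr]
      field_simp
      simp only [map_mul]
      ring
  · rintro _ ⟨x, hx, rfl⟩
    exact algebraMap_mem_tClosure hx

/-- A `t`-ideal `I` strictly containing `Q` lies in no height-one prime. By finite character some
finitely generated `J ⊆ I` already lies in none: take a nonzero `a ∈ Q` and, for each of the
finitely many height-one primes through `a`, an element of `I` outside it. Then `J⁻¹ ⊆ ⋂ R_{Q'} =
R`, so `1 ∈ J_v ⊆ I_t = I`. -/
theorem IsWeaklyKrullDomain.isMaximalTIdeal (h : IsWeaklyKrullDomain R) {Q : Ideal R}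
    (hQ : Q ∈ heightOneSpectrum R) : IsMaximalTIdeal Q := by
  classical
  have hP : Q.IsPrime := hQ.1
  refine ⟨⟨hP.ne_top, isTIdeal_of_mem_heightOneSpectrum hQ⟩, ?_⟩
  rintro I ⟨hI, hIt⟩ hQI
  by_contra hnot
  obtain ⟨-, hQ0, -⟩ := mem_heightOneSpectrum_iff.1 hQ
  obtain ⟨a, haQ, ha⟩ := Submodule.exists_mem_ne_zero_of_ne_bot hQ0
  have hfin := h.finite_character a ha fun hu => hP.ne_top (Ideal.eq_top_of_isUnit_mem _ haQ hu)
  have hex : ∀ Q' : Ideal R, ∃ x ∈ I, Q' ∈ heightOneSpectrum R → x ∉ Q' := by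
    intro Q'
    by_cases hQ' : Q' ∈ heightOneSpectrum R
    · by_contra! hcon
      have hle : I ≤ Q' := fun x hx => (hcon x hx).2
      have := (mem_heightOneSpectrum_iff.1 hQ').2.2 Q hP hQ0 (hQI.trans hle)
      exact hnot (this ▸ hle)
    · exact ⟨0, I.zero_mem, fun h => absurd h hQ'⟩
  choose x hxI hx using hex
  let J : Ideal R := Ideal.span (insert a (hfin.toFinset.image x) : Finset R)
  have haJ : a ∈ J := Ideal.subset_span (by simp)
  have hJ0 : J ≠ ⊥ := fun h0 => ha (by rwa [h0, Ideal.mem_bot] at haJ)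
  have hJI : J ≤ I := by
    rw [Ideal.span_le]
    intro z hz
    simp only [Finset.coe_insert, Finset.coe_image, Set.mem_insert_iff, Set.mem_image] at hz
    rcases hz with rfl | ⟨Q', -, rfl⟩
    · exact hQI haQ
    · exact hxI Q'
  have hJnot : ∀ Q' ∈ heightOneSpectrum R, ∃ j ∈ J, j ∉ Q' := by
    intro Q' hQ'
    by_cases haQ' : a ∈ Q'
    · refine ⟨x Q', Ideal.subset_span ?_, hx Q' hQ'⟩
      simp only [Finset.coe_insert, Finset.coe_image]
      exact Or.inr ⟨Q', by simpa using ⟨hQ', haQ'⟩, rfl⟩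
    · exact ⟨a, haJ, haQ'⟩
  have hinj : Function.Injective (algebraMap R (FractionRing R)) :=
    IsFractionRing.injective R (FractionRing R)
  have hone : (1 : FractionRing R) ∈ tClosure I := by
    refine ⟨J, ⟨_, rfl⟩, hJI, (mem_inv_inv_iff hJ0).2 fun y hy => ?_⟩
    obtain ⟨c, d, hd, rfl⟩ := IsFractionRing.div_surjective (A := R) y
    have hd : d ≠ 0 := nonZeroDivisors.ne_zero hd
    have hd' : algebraMap R (FractionRing R) d ≠ 0 := (map_ne_zero_iff _ hinj).2 hd
    obtain ⟨e, rfl⟩ := iInf_localization_eq_bot_iff.1 h.iInf_localization_eq_bot c d hd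
      fun Q' hQ' => by
        obtain ⟨j, hj, hjQ⟩ := hJnot Q' hQ'
        obtain ⟨r, hr⟩ := hy j hj
        refine ⟨j, hjQ, r, hinj ?_⟩
        rw [map_mul, map_mul, hr]
        field_simp
    exact ⟨e, by rw [map_mul, mul_div_cancel_left₀ _ hd', one_mul]⟩
  rw [hIt] at hone
  obtain ⟨z, hz, hz1⟩ := hone
  rw [← map_one (algebraMap R (FractionRing R))] at hz1
  exact hI ((Ideal.eq_top_iff_one I).2 (hinj hz1 ▸ hz))

end Domain

/-! ### Unique factorization domains -/

section UFD

variable {R : Type*} [CommRing R] [IsDomain R] [UniqueFactorizationMonoid R]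

theorem span_singleton_mem_heightOneSpectrum {p : R} (hp : Prime p) :
    Ideal.span {p} ∈ heightOneSpectrum R := by
  refine mem_heightOneSpectrum_iff.2 ⟨(Ideal.span_singleton_prime hp.ne_zero).2 hp,
    by simpa using hp.ne_zero, fun Q hQ hQ0 hle => le_antisymm hle ?_⟩
  obtain ⟨q, hq, hqp⟩ := hQ.exists_mem_prime_of_ne_bot hQ0
  have hpq : p ∣ q := Ideal.mem_span_singleton.1 (hle hq)
  rw [Ideal.span_singleton_le_iff_mem]
  exact Q.mem_of_dvd ((hp.dvd_prime_iff_associated hqp).1 hpq).symm.dvd hq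

theorem finite_heightOneSpectrum_of_ne_zero {f : R} (hf : f ≠ 0) :
    {P ∈ heightOneSpectrum R | f ∈ P}.Finite := by
  classical
  refine ((UniqueFactorizationMonoid.factors f).toFinset.finite_toSet.image
    fun p => Ideal.span {p}).subset ?_
  rintro P ⟨hP, hfP⟩
  obtain ⟨hprime, -, hmin⟩ := mem_heightOneSpectrum_iff.1 hP
  have hmem : (UniqueFactorizationMonoid.factors f).prod ∈ P :=
    P.mem_of_dvd (UniqueFactorizationMonoid.factors_prod hf).symm.dvd hfP
  obtain ⟨p, hp, hpP⟩ := hprime.multiset_prod_mem_iff_exists_mem _ |>.1 hmem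
  have hpp := UniqueFactorizationMonoid.prime_of_factor p hp
  exact ⟨p, by simpa using hp, hmin _ ((Ideal.span_singleton_prime hpp.ne_zero).2 hpp)
    (by simpa using hpp.ne_zero) (by simpa [Ideal.span_singleton_le_iff_mem] using hpP)⟩

/-- In lowest terms, a prime factor of the denominator would divide neither the numerator nor the
chosen `s`, yet it divides their product. -/
theorem dvd_of_forall_prime_exists_dvd_mul {a b : R} (hb : b ≠ 0)
    (h : ∀ p, Prime p → ∃ s, ¬ p ∣ s ∧ b ∣ a * s) : b ∣ a := by
  obtain ⟨a', b', c, hrel, rfl, rfl⟩ := UniqueFactorizationMonoid.exists_reduced_factors' a b hb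
  have hc : c ≠ 0 := left_ne_zero_of_mul hb
  have hb' : b' ≠ 0 := right_ne_zero_of_mul hb
  refine mul_dvd_mul_left c (IsUnit.dvd ?_)
  by_contra hu
  obtain ⟨p, hp, hpb⟩ := WfDvdMonoid.exists_irreducible_factor hu hb'
  have hpp := UniqueFactorizationMonoid.irreducible_iff_prime.1 hp
  obtain ⟨s, hs, hdvd⟩ := h p hpp
  rw [mul_assoc, mul_dvd_mul_iff_left hc] at hdvd
  rcases hpp.dvd_or_dvd (hpb.trans hdvd) with h1 | h1
  · exact hp.not_isUnit (hrel h1 hpb)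
  · exact hs h1

end UFD

/-! ### Group algebras as localizations, and restriction to subgroups -/

theorem exists_single_mul_mem_range_mapDomainRingHom {K S G : Type*} [CommRing K] [AddCommMonoid S]
    [AddCommGroup G] (φ : S →+ G) (hφ : ∀ g, ∃ a b, g = φ a - φ b) (f : K[G]) :
    ∃ (s : S) (h : K[S]), f * AddMonoidAlgebra.single (φ s) 1 =
      AddMonoidAlgebra.mapDomainRingHom K φ h := by
  induction f using AddMonoidAlgebra.induction_linear with
  | zero => exact ⟨0, 0, by simp⟩
  | single g r =>
    obtain ⟨a, b, rfl⟩ := hφ g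
    exact ⟨b, AddMonoidAlgebra.single a r, by
      simp [AddMonoidAlgebra.single_mul_single, AddMonoidAlgebra.mapDomainRingHom]⟩
  | add f g hf hg =>
    obtain ⟨s, h, hs⟩ := hf
    obtain ⟨t, k, ht⟩ := hg
    refine ⟨s + t, h * AddMonoidAlgebra.single t 1 + k * AddMonoidAlgebra.single s 1, ?_⟩
    have hst : (AddMonoidAlgebra.single (φ (s + t)) 1 : K[G]) =
        AddMonoidAlgebra.single (φ s) 1 * AddMonoidAlgebra.single (φ t) 1 := by
      rw [AddMonoidAlgebra.single_mul_single, map_add, mul_one]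
    have hm : ∀ x : S, AddMonoidAlgebra.mapDomainRingHom K φ (AddMonoidAlgebra.single x 1) =
        AddMonoidAlgebra.single (φ x) 1 := fun x => by simp [AddMonoidAlgebra.mapDomainRingHom]
    rw [hst, map_add, map_mul, map_mul, hm, hm, ← hs, ← ht]
    ring

theorem isUnit_single {K G : Type*} [Field K] [AddCommGroup G] (g : G) {r : K} (hr : r ≠ 0) :
    IsUnit (AddMonoidAlgebra.single g r : K[G]) :=
  IsUnit.of_mul_eq_one (AddMonoidAlgebra.single (-g) r⁻¹) (by
    rw [AddMonoidAlgebra.single_mul_single, add_neg_cancel, mul_inv_cancel₀ hr]; rfl)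

theorem mapDomainRingHom_injective {K S G : Type*} [CommRing K] [AddCommMonoid S]
    [AddCommMonoid G] {φ : S →+ G} (hφ : Function.Injective φ) :
    Function.Injective (AddMonoidAlgebra.mapDomainRingHom K φ) :=
  AddMonoidAlgebra.mapDomain_injective hφ

/-- `K[G]` is the localization of `K[S]` at the monomials. -/
theorem isLocalization_mapDomainRingHom {K S G : Type*} [Field K] [AddCommMonoid S]
    [AddCommGroup G] (φ : S →+ G) (hinj : Function.Injective φ) (hφ : ∀ g, ∃ a b, g = φ a - φ b) :
    letI := (AddMonoidAlgebra.mapDomainRingHom K φ).toAlgebra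
    IsLocalization (MonoidHom.mrange (AddMonoidAlgebra.of K S)) K[G] := by
  let _ := (AddMonoidAlgebra.mapDomainRingHom K φ).toAlgebra
  have halg : ∀ s : S, algebraMap K[S] K[G] (AddMonoidAlgebra.single s 1) =
      AddMonoidAlgebra.single (φ s) 1 := fun s => by
    simp [RingHom.algebraMap_toAlgebra, AddMonoidAlgebra.mapDomainRingHom]
  refine ⟨⟨?_, ?_, ?_⟩⟩
  · rintro ⟨_, s, rfl⟩
    have := halg s.toAdd
    simp only [AddMonoidAlgebra.of_apply, this]
    exact isUnit_single _ one_ne_zero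
  · intro f
    obtain ⟨s, h, hs⟩ := exists_single_mul_mem_range_mapDomainRingHom φ hφ f
    exact ⟨(h, ⟨_, Multiplicative.ofAdd s, rfl⟩), by
      simp only [AddMonoidAlgebra.of_apply, toAdd_ofAdd, halg]; exact hs⟩
  · intro x y h
    exact ⟨1, by rw [mapDomainRingHom_injective hinj h]⟩

/-- Laurent polynomials are the localization of the polynomial ring at its monomials, and
localization preserves factoriality. -/
theorem uniqueFactorizationMonoid_addMonoidAlgebra_finsupp_int (K σ : Type*) [Field K] :
    UniqueFactorizationMonoid K[σ →₀ ℤ] := by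
  have : UniqueFactorizationMonoid K[σ →₀ ℕ] :=
    inferInstanceAs (UniqueFactorizationMonoid (MvPolynomial σ K))
  let φ : (σ →₀ ℕ) →+ (σ →₀ ℤ) := Finsupp.mapRange.addMonoidHom (Nat.castAddMonoidHom ℤ)
  let _ := (AddMonoidAlgebra.mapDomainRingHom K φ).toAlgebra
  have : IsLocalization (MonoidHom.mrange (AddMonoidAlgebra.of K (σ →₀ ℕ))) K[σ →₀ ℤ] := by
    refine isLocalization_mapDomainRingHom φ
      (Finsupp.mapRange_injective _ (map_zero _) Nat.cast_injective) fun g =>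
      ⟨g.mapRange Int.toNat rfl, (-g).mapRange Int.toNat rfl, ?_⟩
    ext i
    simp [φ]
  exact UniqueFactorizationMonoid.of_isLocalization
    (MonoidHom.mrange (AddMonoidAlgebra.of K (σ →₀ ℕ))) K[σ →₀ ℤ]

theorem uniqueFactorizationMonoid_addMonoidAlgebra_of_fg (K H : Type*) [Field K] [AddCommGroup H]
    [IsAddTorsionFree H] [Module.Finite ℤ H] : UniqueFactorizationMonoid K[H] := by
  have := uniqueFactorizationMonoid_addMonoidAlgebra_finsupp_int K
    (Module.Free.ChooseBasisIndex ℤ H)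
  exact (AddMonoidAlgebra.mapDomainRingEquiv K
    (Module.Free.chooseBasis ℤ H).repr.symm.toAddEquiv).toMulEquiv.uniqueFactorizationMonoid this

section Restriction

variable {K G : Type*} [Field K] [AddCommGroup G] (H : AddSubgroup G)

/-- Discarding the exponents outside `H` is a `K[H]`-linear retraction of `K[G]` onto `K[H]`,
because translation by `H` preserves the complement of `H`. It brings inverses from `K[G]` back to
`K[H]`. -/
theorem comapDomain_mapDomain_mul (x : K[H]) (y : K[G]) :
    AddMonoidAlgebra.comapDomain H.subtype H.subtype_injective
      (AddMonoidAlgebra.mapDomainRingHom K H.subtype x * y) =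
      x * AddMonoidAlgebra.comapDomain H.subtype H.subtype_injective y := by
  have hm : ∀ (h : H) (r : K), AddMonoidAlgebra.mapDomainRingHom K H.subtype
      (AddMonoidAlgebra.single h r) = AddMonoidAlgebra.single (h : G) r := fun h r => by
    simp [AddMonoidAlgebra.mapDomainRingHom]
  induction x using AddMonoidAlgebra.induction_linear with
  | zero => simp
  | add x x' hx hx' => rw [map_add, add_mul, AddMonoidAlgebra.comapDomain_add, hx, hx', add_mul]
  | single h r =>
    induction y using AddMonoidAlgebra.induction_linear with
    | zero => simp
    | add y y' hy hy' =>
      rw [mul_add, AddMonoidAlgebra.comapDomain_add, hy, hy', AddMonoidAlgebra.comapDomain_add,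
        mul_add]
    | single g s =>
      rw [hm, AddMonoidAlgebra.single_mul_single]
      by_cases hg : g ∈ H
      · obtain ⟨g, rfl⟩ : ∃ g' : H, g = H.subtype g' := ⟨⟨g, hg⟩, rfl⟩
        rw [show (h : G) + H.subtype g = H.subtype (h + g) from rfl,
          AddMonoidAlgebra.comapDomain_single_map, AddMonoidAlgebra.comapDomain_single_map,
          AddMonoidAlgebra.single_mul_single]
      · have hz : ∀ g' : G, g' ∉ H → ∀ t : K, AddMonoidAlgebra.comapDomain H.subtype
            H.subtype_injective (AddMonoidAlgebra.single g' t) = 0 := fun g' hg' t => by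
          ext x
          have : g' ≠ x := fun h => hg' (h ▸ x.2)
          simp [this]
        rw [hz _ hg, hz _ (by simpa [AddSubgroup.add_mem_cancel_left] using hg), mul_zero]

theorem comapDomain_mapDomain (x : K[H]) :
    AddMonoidAlgebra.comapDomain H.subtype H.subtype_injective
      (AddMonoidAlgebra.mapDomainRingHom K H.subtype x) = x := by
  have h1 : AddMonoidAlgebra.comapDomain H.subtype H.subtype_injective (1 : K[G]) = 1 :=
    AddMonoidAlgebra.comapDomain_single_map H.subtype H.subtype_injective 0 (1 : K)
  have := comapDomain_mapDomain_mul H x 1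
  rwa [mul_one, h1, mul_one] at this

theorem exists_mapDomain_eq {f : K[G]} (hf : ∀ g ∈ f.coeff.support, g ∈ H) :
    ∃ x : K[H], AddMonoidAlgebra.mapDomainRingHom K H.subtype x = f :=
  ⟨_, AddMonoidAlgebra.mapDomain_comapDomain (f := H.subtype) (fun g hg => ⟨⟨g, hf g hg⟩, rfl⟩)
    H.subtype_injective⟩

theorem isUnit_of_isUnit_mapDomain {x : K[H]}
    (hx : IsUnit (AddMonoidAlgebra.mapDomainRingHom K H.subtype x)) : IsUnit x := by
  obtain ⟨y, hy⟩ := hx.exists_right_inv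
  refine IsUnit.of_mul_eq_one (AddMonoidAlgebra.comapDomain H.subtype H.subtype_injective y) ?_
  rw [← comapDomain_mapDomain_mul, hy, ← map_one (AddMonoidAlgebra.mapDomainRingHom K H.subtype),
    comapDomain_mapDomain]

end Restriction

/-- A relation `a * b = f * c` involves finitely many exponents, so it lives in `K[H]` with `H`
finitely generated, hence free, and `K[H]` factorial. Irreducibility of `f` descends because units
of `K[G]` lying in `K[H]` are units there. -/
theorem prime_of_irreducible_addMonoidAlgebra {K G : Type*} [Field K] [AddCommGroup G]
    [IsAddTorsionFree G] {f : K[G]} (hf : Irreducible f) : Prime f := by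
  classical
  refine ⟨hf.ne_zero, hf.not_isUnit, ?_⟩
  rintro a b ⟨c, hc⟩
  obtain ⟨H, hH, hfH, haH, hbH, hcH⟩ : ∃ H : AddSubgroup G, UniqueFactorizationMonoid K[H] ∧
      (∀ g ∈ f.coeff.support, g ∈ H) ∧ (∀ g ∈ a.coeff.support, g ∈ H) ∧
      (∀ g ∈ b.coeff.support, g ∈ H) ∧ ∀ g ∈ c.coeff.support, g ∈ H := by
    let A : Finset G := f.coeff.support ∪ a.coeff.support ∪ b.coeff.support ∪ c.coeff.support
    let H : AddSubgroup G := AddSubgroup.closure A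
    have : AddGroup.FG H := (AddGroup.fg_iff_addSubgroup_fg H).2 ⟨A, rfl⟩
    have : Module.Finite ℤ H := Module.Finite.iff_addGroup_fg.2 this
    have hA : ∀ g ∈ A, g ∈ H := fun g hg => AddSubgroup.subset_closure hg
    exact ⟨H, uniqueFactorizationMonoid_addMonoidAlgebra_of_fg K H,
      fun g hg => hA g (by simp [A, -Finsupp.mem_support_iff, hg]),
      fun g hg => hA g (by simp [A, -Finsupp.mem_support_iff, hg]),
      fun g hg => hA g (by simp [A, -Finsupp.mem_support_iff, hg]),
      fun g hg => hA g (by simp [A, -Finsupp.mem_support_iff, hg])⟩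
  obtain ⟨f', rfl⟩ := exists_mapDomain_eq H hfH
  obtain ⟨a', rfl⟩ := exists_mapDomain_eq H haH
  obtain ⟨b', rfl⟩ := exists_mapDomain_eq H hbH
  obtain ⟨c', rfl⟩ := exists_mapDomain_eq H hcH
  rw [← map_mul, ← map_mul] at hc
  have hc := mapDomainRingHom_injective H.subtype_injective hc
  have hirr : Irreducible f' := by
    refine ⟨fun h => hf.not_isUnit (h.map _), fun x y hxy => ?_⟩
    rw [hxy, map_mul] at hf
    exact (hf.isUnit_or_isUnit rfl).imp (isUnit_of_isUnit_mapDomain H)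
      (isUnit_of_isUnit_mapDomain H)
  exact ((UniqueFactorizationMonoid.irreducible_iff_prime.1 hirr).dvd_or_dvd ⟨c', hc⟩).imp
    (map_dvd _) (map_dvd _)

/-! ### Rational functionals on torsion-free groups -/

section Functionals

variable {G : Type*} [AddCommGroup G]

theorem exists_addMonoidHom_rat_ne_zero [IsAddTorsionFree G] {g : G} (hg : g ≠ 0) :
    ∃ κ : G →+ ℚ, κ g ≠ 0 := by
  have h0 : (g : DivisibleHull G) ≠ 0 := fun h =>
    hg (DivisibleHull.coe_injective (h.trans (DivisibleHull.mk_zero 1).symm))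
  obtain ⟨l, hl⟩ := Module.Projective.exists_dual_ne_zero ℚ h0
  exact ⟨l.toAddMonoidHom.comp (DivisibleHull.coeAddMonoidHom (M := G)), hl⟩

/-- Evaluation of rational functionals at a group element. -/
def evalRatFunctional (g : G) : Module.Dual ℚ (G →+ ℚ) where
  toFun κ := κ g
  map_add' _ _ := rfl
  map_smul' _ _ := rfl

/-- Two functionals in general position with respect to a finite set: the first is injective on
the set, and together they detect which differences are not proportional. -/
theorem exists_generic_functionals [IsAddTorsionFree G] (A : Finset G) :
    ∃ l m : G →+ ℚ, (∀ a ∈ A, ∀ b ∈ A, l a = l b → a = b) ∧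
      ∀ a ∈ A, ∀ b ∈ A, ∀ c ∈ A, l (b - a) * m (c - a) = l (c - a) * m (b - a) →
        ∀ κ : G →+ ℚ, l (b - a) * κ (c - a) = l (c - a) * κ (b - a) := by
  -- Finitely many nonzero linear forms on a vector space over the infinite field `ℚ` have a common
  -- nonvanishing point. This is used for evaluations at differences to find `l`, and for the 2×2
  -- determinants `F` to find `m`.
  obtain ⟨l, hl⟩ := Module.Dual.exists_forall_ne_zero_of_forall_exists
    (fun p : {p : A × A // p.1 ≠ p.2} => evalRatFunctional ((p.1.1 : G) - p.1.2)) fun p =>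
      exists_addMonoidHom_rat_ne_zero (sub_ne_zero.2 fun h => p.2 (Subtype.ext h))
  let F : A × A × A → Module.Dual ℚ (G →+ ℚ) := fun p =>
    l (p.2.1 - p.1 : G) • evalRatFunctional (p.2.2 - p.1 : G) -
      l (p.2.2 - p.1 : G) • evalRatFunctional (p.2.1 - p.1 : G)
  obtain ⟨m, hm⟩ := Module.Dual.exists_forall_ne_zero_of_forall_exists
    (fun p : {p : A × A × A // ∃ κ, F p κ ≠ 0} => F p.1) fun p => p.2
  refine ⟨l, m, fun a ha b hb hab => ?_, fun a ha b hb c hc h κ => ?_⟩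
  · by_contra hne
    refine hl ⟨(⟨a, ha⟩, ⟨b, hb⟩), fun h => hne (congrArg Subtype.val h)⟩ ?_
    change l (a - b) = 0
    rw [map_sub, hab, sub_self]
  · by_contra hne
    refine hm ⟨(⟨a, ha⟩, ⟨b, hb⟩, ⟨c, hc⟩), κ, fun h0 => hne (sub_eq_zero.1 h0)⟩ ?_
    exact sub_eq_zero.2 h

/-- Under the ascending chain condition on cyclic subgroups, a subgroup of rank one is discrete
in `ℚ`. -/
theorem SatisfiesACCOnCyclicSubgroups.exists_pos_le_abs (hG : SatisfiesACCOnCyclicSubgroups G)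
    (l : G →+ ℚ) (H : AddSubgroup G) (hl : ∀ x ∈ H, l x = 0 → x = 0) :
    ∃ e : ℚ, 0 < e ∧ ∀ x ∈ H, x ≠ 0 → e ≤ |l x| := by
  -- The chain condition yields a maximal cyclic subgroup of `H`, generated by `x`. It will be all
  -- of `H`, so `|l x|` is the desired bound unless `H` is trivial.
  obtain ⟨x, hxH, hx⟩ : ∃ x ∈ H, ∀ y ∈ H, AddSubgroup.zmultiples x ≤ AddSubgroup.zmultiples y →
      AddSubgroup.zmultiples y ≤ AddSubgroup.zmultiples x := by
    by_contra! hcon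
    choose! next hnextH hle hnot using hcon
    let u : ℕ → G := fun n => next^[n] 0
    have huH : ∀ n, u n ∈ H := fun n => by
      induction n with
      | zero => exact H.zero_mem
      | succ n ih => simp only [u, Function.iterate_succ_apply']; exact hnextH _ ih
    have hsucc : ∀ n, u (n + 1) = next (u n) := fun n => Function.iterate_succ_apply' _ _ _
    obtain ⟨n, hn⟩ := hG ⟨fun n => AddSubgroup.zmultiples (u n), monotone_nat_of_le_succ fun n => by
      rw [hsucc]; exact hle _ (huH n)⟩ fun n => ⟨u n, rfl⟩
    refine hnot (u n) (huH n) ?_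
    rw [← hsucc]
    exact (hn (n + 1) n.le_succ).ge
  by_cases hx0 : x = 0
  · refine ⟨1, one_pos, fun y hy hy0 => absurd ?_ hy0⟩
    have := hx y hy (by simp [hx0]) (AddSubgroup.mem_zmultiples y)
    simpa [hx0] using this
  have hlx : l x ≠ 0 := fun h => hx0 (hl x hxH h)
  refine ⟨|l x|, abs_pos.2 hlx, fun y hy hy0 => ?_⟩
  have hly : l y ≠ 0 := fun h => hy0 (hl y hy h)
  let r : ℚ := l y / l x
  have hr : (r.den : ℤ) • y = r.num • x := by
    rw [← sub_eq_zero]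
    refine hl _ (H.sub_mem (H.zsmul_mem hy _) (H.zsmul_mem hxH _)) ?_
    have h1 : (r.num : ℚ) = r * r.den := (Rat.mul_den_eq_num r).symm
    rw [map_sub, map_zsmul, map_zsmul, zsmul_eq_mul, zsmul_eq_mul, h1]
    simp only [r]
    push_cast
    field_simp
    ring
  obtain ⟨s, t, hst⟩ : ∃ s t : ℤ, s * r.num + t * r.den = 1 :=
    Int.isCoprime_iff_gcd_eq_one.2 (by simpa [Int.gcd] using r.reduced)
  -- The Bézout combination `s • y + t • x` is a root of `x` in `H`. Maximality of `x` puts it among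
  -- the multiples of `x`, so the denominator of `l y / l x` is one.
  have hz : (r.den : ℤ) • (s • y + t • x) = x := by
    rw [smul_add, smul_comm _ s y, hr, smul_comm _ t x, smul_smul, smul_smul, ← add_smul, hst,
      one_smul]
  have hzH : s • y + t • x ∈ H := H.add_mem (H.zsmul_mem hy _) (H.zsmul_mem hxH _)
  have hmem := hx _ hzH (by
    rw [AddSubgroup.zmultiples_le]
    exact AddSubgroup.mem_zmultiples_iff.2 ⟨_, hz⟩) (AddSubgroup.mem_zmultiples _)
  obtain ⟨k, hk⟩ := AddSubgroup.mem_zmultiples_iff.1 hmem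
  have hden : (r.den : ℤ) * k = 1 := by
    have h1 := congrArg l hz
    rw [← hk, smul_smul, map_zsmul, zsmul_eq_mul] at h1
    have h2 := mul_right_cancel₀ hlx (h1.trans (one_mul _).symm)
    exact_mod_cast h2
  have hden1 : r.den = 1 := by
    have := Int.eq_one_or_neg_one_of_mul_eq_one hden
    omega
  have hrint : (r.num : ℚ) = r := by
    have := Rat.mul_den_eq_num r
    rw [hden1] at this
    simpa using this.symm
  have hr0 : r ≠ 0 := div_ne_zero hly hlx
  have hnum : r.num ≠ 0 := Rat.num_ne_zero.2 hr0
  have habs : (1 : ℚ) ≤ |r| := by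
    rw [← hrint]
    exact_mod_cast Int.one_le_abs hnum
  have hyr : l y = r * l x := by simp only [r]; field_simp
  rw [hyr, abs_mul]
  exact le_mul_of_one_le_left (abs_nonneg _) habs

end Functionals

/-! ### Widths of faces of supports -/

theorem support_nonempty_of_ne_zero {K M : Type*} [Semiring K] {f : K[M]} (hf : f ≠ 0) :
    f.coeff.support.Nonempty := by
  simpa using hf

section FaceWidth

variable {K G : Type*} [Field K] [AddCommGroup G]

/-- `x` lies on the face of the support of `f` where `ν` is maximal. -/
def IsOnFace (ν : G →+ ℚ) (f : K[G]) (x : G) : Prop :=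
  x ∈ f.coeff.support ∧ ∀ y ∈ f.coeff.support, ν y ≤ ν x

/-- `x` maximizes `κ` on the face of the support of `f` where `ν` is maximal. -/
def IsLexTop (ν κ : G →+ ℚ) (f : K[G]) (x : G) : Prop :=
  x ∈ f.coeff.support ∧ ∀ y ∈ f.coeff.support, ν y ≤ ν x ∧ (ν y = ν x → κ y ≤ κ x)

theorem IsLexTop.isOnFace {ν κ : G →+ ℚ} {f : K[G]} {x : G} (h : IsLexTop ν κ f x) :
    IsOnFace ν f x := ⟨h.1, fun y hy => (h.2 y hy).1⟩

theorem IsOnFace.eq {ν : G →+ ℚ} {f : K[G]} {x y : G} (hx : IsOnFace ν f x) (hy : IsOnFace ν f y) :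
    ν x = ν y := le_antisymm (hy.2 x hx.1) (hx.2 y hy.1)

theorem IsLexTop.eq {ν κ : G →+ ℚ} {f : K[G]} {x y : G} (hx : IsLexTop ν κ f x)
    (hy : IsLexTop ν κ f y) : κ x = κ y :=
  have h := hx.isOnFace.eq hy.isOnFace
  le_antisymm ((hy.2 x hx.1).2 h) ((hx.2 y hy.1).2 h.symm)

theorem exists_isLexTop (ν κ : G →+ ℚ) {f : K[G]} (hf : f ≠ 0) : ∃ x, IsLexTop ν κ f x := by
  obtain ⟨x, hx, hmax⟩ := Finset.exists_max_image f.coeff.support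
    (fun x => toLex (ν x, κ x)) (support_nonempty_of_ne_zero hf)
  refine ⟨x, hx, fun y hy => ?_⟩
  have := hmax y hy
  rw [Prod.Lex.toLex_le_toLex] at this
  rcases this with h | ⟨h1, h2⟩
  · exact ⟨le_of_lt h, fun h' => absurd h' (ne_of_lt h)⟩
  · exact ⟨h1.le, fun _ => h2⟩

/-- The top of a product is the sum of the tops. As `(ν, κ)` need not separate points, several
exponents can share the top value, so a unique sum among them supplies a coefficient that cannot
cancel. Additivity of `faceWidth` rests on this. -/
theorem IsLexTop.mul [IsAddTorsionFree G] {ν κ : G →+ ℚ} {f g : K[G]} {x y : G}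
    (hx : IsLexTop ν κ f x) (hy : IsLexTop ν κ g y) :
    ∃ z, IsLexTop ν κ (f * g) z ∧ κ z = κ x + κ y := by
  classical
  let A := f.coeff.support.filter fun a => ν a = ν x ∧ κ a = κ x
  let B := g.coeff.support.filter fun b => ν b = ν y ∧ κ b = κ y
  obtain ⟨a, ha, b, hb, hab⟩ := UniqueSums.uniqueAdd_of_nonempty (A := A) (B := B)
    ⟨x, by simpa [A] using hx.1⟩ ⟨y, by simpa [B] using hy.1⟩
  obtain ⟨haf, hνa, hκa⟩ := Finset.mem_filter.1 ha
  obtain ⟨hbg, hνb, hκb⟩ := Finset.mem_filter.1 hb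
  have huniq : UniqueAdd f.coeff.support g.coeff.support a b := by
    intro a' b' ha' hb' h
    have h1 := hx.2 a' ha'
    have h2 := hy.2 b' hb'
    have h3 := congrArg ν h
    have h4 := congrArg κ h
    rw [map_add, map_add] at h3 h4
    have ha1 : ν a' = ν x := by linarith [h1.1, h2.1]
    have hb1 : ν b' = ν y := by linarith
    have ha2 := h1.2 ha1
    have hb2 := h2.2 hb1
    exact hab (Finset.mem_filter.2 ⟨ha', ha1, by linarith⟩)
      (Finset.mem_filter.2 ⟨hb', hb1, by linarith⟩) h
  have hcoeff := AddMonoidAlgebra.coeff_mul_add_of_uniqueAdd huniq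
  refine ⟨a + b, ⟨?_, fun z hz => ?_⟩, by rw [map_add, hκa, hκb]⟩
  · rw [Finsupp.mem_support_iff, hcoeff]
    exact mul_ne_zero (Finsupp.mem_support_iff.1 haf) (Finsupp.mem_support_iff.1 hbg)
  · obtain ⟨a', ha', b', hb', rfl⟩ :=
      Finset.mem_add.1 (AddMonoidAlgebra.support_coeff_mul_subset f g hz)
    have h1 := hx.2 a' ha'
    have h2 := hy.2 b' hb'
    simp only [map_add]
    refine ⟨by linarith [h1.1, h2.1], fun h => ?_⟩
    have ha1 : ν a' = ν x := by linarith [h1.1, h2.1]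
    have hb1 : ν b' = ν y := by linarith
    linarith [h1.2 ha1, h2.2 hb1]

open Classical in
/-- The maximum of `κ` on the face of the support of `f` where `ν` is maximal. -/
noncomputable def faceMax (ν κ : G →+ ℚ) (f : K[G]) : ℚ :=
  if h : ∃ x, IsLexTop ν κ f x then κ h.choose else 0

theorem IsLexTop.faceMax_eq {ν κ : G →+ ℚ} {f : K[G]} {x : G} (h : IsLexTop ν κ f x) :
    faceMax ν κ f = κ x := by
  have hex : ∃ x, IsLexTop ν κ f x := ⟨x, h⟩
  rw [faceMax, dif_pos hex]
  exact hex.choose_spec.eq h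

theorem faceMax_mul [IsAddTorsionFree G] (ν κ : G →+ ℚ) {f g : K[G]} (hf : f ≠ 0) (hg : g ≠ 0) :
    faceMax ν κ (f * g) = faceMax ν κ f + faceMax ν κ g := by
  obtain ⟨x, hx⟩ := exists_isLexTop ν κ hf
  obtain ⟨y, hy⟩ := exists_isLexTop ν κ hg
  obtain ⟨z, hz, h⟩ := hx.mul hy
  rw [hz.faceMax_eq, hx.faceMax_eq, hy.faceMax_eq, h]

/-- The width with respect to `κ` of the face of the support of `f` where `ν` is maximal. -/
noncomputable def faceWidth (ν κ : G →+ ℚ) (f : K[G]) : ℚ :=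
  faceMax ν κ f + faceMax ν (-κ) f

theorem faceWidth_mul [IsAddTorsionFree G] (ν κ : G →+ ℚ) {f g : K[G]} (hf : f ≠ 0) (hg : g ≠ 0) :
    faceWidth ν κ (f * g) = faceWidth ν κ f + faceWidth ν κ g := by
  simp only [faceWidth, faceMax_mul _ _ hf hg]
  ring

theorem exists_faceWidth_eq (ν κ : G →+ ℚ) {f : K[G]} (hf : f ≠ 0) :
    ∃ x y, IsOnFace ν f x ∧ IsOnFace ν f y ∧ faceWidth ν κ f = κ (x - y) := by
  obtain ⟨x, hx⟩ := exists_isLexTop ν κ hf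
  obtain ⟨y, hy⟩ := exists_isLexTop ν (-κ) hf
  refine ⟨x, y, hx.isOnFace, hy.isOnFace, ?_⟩
  rw [faceWidth, hx.faceMax_eq, hy.faceMax_eq, map_sub, AddMonoidHom.neg_apply, sub_eq_add_neg]

theorem IsOnFace.sub_le_faceWidth {ν : G →+ ℚ} (κ : G →+ ℚ) {f : K[G]} {x y : G}
    (hx : IsOnFace ν f x) (hy : IsOnFace ν f y) : κ (x - y) ≤ faceWidth ν κ f := by
  have hf : f ≠ 0 := fun h => by simpa [h] using hx.1
  obtain ⟨p, hp⟩ := exists_isLexTop ν κ hf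
  obtain ⟨q, hq⟩ := exists_isLexTop ν (-κ) hf
  have h1 := (hp.2 x hx.1).2 (hx.eq hp.isOnFace)
  have h2 := (hq.2 y hy.1).2 (hy.eq hq.isOnFace)
  rw [faceWidth, hp.faceMax_eq, hq.faceMax_eq, map_sub]
  simp only [AddMonoidHom.neg_apply] at h2 ⊢
  linarith

theorem faceWidth_nonneg (ν κ : G →+ ℚ) {f : K[G]} (hf : f ≠ 0) : 0 ≤ faceWidth ν κ f := by
  obtain ⟨x, -, hx, -⟩ := exists_faceWidth_eq ν κ hf
  simpa using hx.sub_le_faceWidth κ hx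

theorem faceWidth_le_of_dvd [IsAddTorsionFree G] (ν κ : G →+ ℚ) {f g : K[G]} (hf : f ≠ 0)
    (h : g ∣ f) : faceWidth ν κ g ≤ faceWidth ν κ f := by
  obtain ⟨q, rfl⟩ := h
  rw [faceWidth_mul ν κ (left_ne_zero_of_mul hf) (right_ne_zero_of_mul hf)]
  linarith [faceWidth_nonneg ν κ (right_ne_zero_of_mul hf)]

/-- A functional that is constant on a face of `f` is constant on the corresponding face of any
divisor of `f`. -/
theorem IsOnFace.map_sub_eq_zero_of_dvd [IsAddTorsionFree G] {ν : G →+ ℚ} (κ : G →+ ℚ) {f g : K[G]}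
    (hf : f ≠ 0) (hκ : ∀ a b, IsOnFace ν f a → IsOnFace ν f b → κ (a - b) = 0) (h : g ∣ f) {x y : G}
    (hx : IsOnFace ν g x) (hy : IsOnFace ν g y) : κ (x - y) = 0 := by
  obtain ⟨a, b, ha, hb, hab⟩ := exists_faceWidth_eq ν κ hf
  have h0 : faceWidth ν κ g ≤ 0 := (faceWidth_le_of_dvd ν κ hf h).trans (by rw [hab, hκ a b ha hb])
  have h1 := hx.sub_le_faceWidth κ hy
  have h2 := hy.sub_le_faceWidth κ hx
  rw [map_sub] at *
  linarith

end FaceWidth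

/-! ### Group algebras with the ascending chain condition on cyclic subgroups are factorial -/

section Factorial

variable {K G : Type*} [Field K] [AddCommGroup G]

theorem exists_ne_mem_support_of_not_isUnit {g : K[G]} (hg : g ≠ 0) (hu : ¬ IsUnit g) :
    ∃ x ∈ g.coeff.support, ∃ y ∈ g.coeff.support, x ≠ y := by
  obtain ⟨x, hx⟩ := support_nonempty_of_ne_zero hg
  by_contra! hcon
  refine hu ?_
  have hgx : g = AddMonoidAlgebra.single x (g.coeff x) := by
    ext y
    by_cases hy : y = x
    · simp [hy]
    · have : y ∉ g.coeff.support := fun h => hy (hcon y h x hx)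
      rw [Finsupp.notMem_support_iff.1 this, AddMonoidAlgebra.coeff_single,
        Finsupp.single_eq_of_ne hy]
  rw [hgx]
  exact isUnit_single x (Finsupp.mem_support_iff.1 hx)

theorem faceWidth_pos_of_ne {ν κ : G →+ ℚ} {f : K[G]} {x y : G} (hx : IsOnFace ν f x)
    (hy : IsOnFace ν f y) (h : κ x ≠ κ y) : 0 < faceWidth ν κ f := by
  have h1 := hx.sub_le_faceWidth κ hy
  have h2 := hy.sub_le_faceWidth κ hx
  rw [map_sub] at h1 h2
  rcases lt_or_gt_of_ne h with h | h <;> linarith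

/-- A Laurent polynomial on which `l` is not constant has an edge that is visible in the pencil
of functionals `m + t l`. -/
theorem exists_pos_faceWidth_pencil (l m : G →+ ℚ) {g : K[G]}
    (hl : ∃ x ∈ g.coeff.support, ∃ y ∈ g.coeff.support, l x ≠ l y) :
    ∃ t : ℚ, 0 < faceWidth (m + t • l) l g := by
  classical
  obtain ⟨x, hx, y, hy, hxy⟩ := hl
  have hg : g ≠ 0 := fun h => by simp [h] at hx
  obtain ⟨u, hu⟩ := exists_isLexTop l m hg
  let B := g.coeff.support.filter fun c => l c < l u
  have hB : B.Nonempty := by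
    by_contra hB
    rw [Finset.not_nonempty_iff_eq_empty, Finset.filter_eq_empty_iff] at hB
    exact hxy ((le_antisymm (hu.2 x hx).1 (not_lt.1 (hB hx))).trans
      (le_antisymm (hu.2 y hy).1 (not_lt.1 (hB hy))).symm)
  -- In the projection by `(l, m)`, `u` is the upper right-hand vertex, and the maximizing `c` spans
  -- with it the next edge of the upper hull. The maximal value is the `t` for which `m + t • l`
  -- agrees on `u` and `c`.
  obtain ⟨c, hc, hmax⟩ := Finset.exists_max_image B (fun c => (m c - m u) / (l u - l c)) hB
  obtain ⟨hcg, hcu⟩ := Finset.mem_filter.1 hc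
  let t := (m c - m u) / (l u - l c)
  have happ : ∀ z, (m + t • l) z = m z + t * l z := fun z => rfl
  have hcu' : 0 < l u - l c := sub_pos.2 hcu
  have ht : m c + t * l c = m u + t * l u := by
    have : t * (l u - l c) = m c - m u := div_mul_cancel₀ _ hcu'.ne'
    linarith
  have huf : IsOnFace (m + t • l) g u := by
    refine ⟨hu.1, fun z hz => ?_⟩
    rw [happ, happ]
    rcases (hu.2 z hz).1.lt_or_eq with h | h
    · have hzu : 0 < l u - l z := sub_pos.2 h
      have := hmax z (Finset.mem_filter.2 ⟨hz, h⟩)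
      rw [div_le_iff₀ hzu] at this
      change m z - m u ≤ t * _ at this
      linarith
    · rw [h]
      linarith [(hu.2 z hz).2 h]
  have hcf : IsOnFace (m + t • l) g c := by
    refine ⟨hcg, fun z hz => ?_⟩
    rw [happ c, ht, ← happ u]
    exact huf.2 z hz
  exact ⟨t, faceWidth_pos_of_ne huf hcf hcu.ne'⟩

/-- The elements proportional to `d` in the rational hull of `G`, when `l d ≠ 0`. -/
def proportionalSubgroup (l : G →+ ℚ) (d : G) : AddSubgroup G where
  carrier := {x | ∀ κ : G →+ ℚ, l d * κ x = l x * κ d}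
  zero_mem' := by simp
  add_mem' {x y} hx hy κ := by
    rw [map_add, map_add, mul_add, add_mul, hx κ, hy κ]
  neg_mem' {x} hx κ := by
    rw [map_neg, map_neg, mul_neg, neg_mul, hx κ]

/-- By genericity of `l` and `m`, each face of `f` cut out by `m + t • l` lies on a line. The
corresponding face of a divisor `g` is parallel to that line, so its width is a value of `l` on a
rank-one subgroup, where the chain condition makes `l` discrete. If the face of `f` is a point, no
divisor has positive width. -/
theorem exists_pos_le_faceWidth_of_dvd [IsAddTorsionFree G] (hG : SatisfiesACCOnCyclicSubgroups G)
    {f : K[G]} (hf : f ≠ 0) (l m : G →+ ℚ)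
    (hl : ∀ a ∈ f.coeff.support, ∀ b ∈ f.coeff.support, l a = l b → a = b)
    (hm : ∀ a ∈ f.coeff.support, ∀ b ∈ f.coeff.support, ∀ c ∈ f.coeff.support,
      l (b - a) * m (c - a) = l (c - a) * m (b - a) →
        ∀ κ : G →+ ℚ, l (b - a) * κ (c - a) = l (c - a) * κ (b - a)) (t : ℚ) :
    ∃ e : ℚ, 0 < e ∧ ∀ g : K[G], g ∣ f → 0 < faceWidth (m + t • l) l g →
      e ≤ faceWidth (m + t • l) l g := by
  by_cases hface : ∃ a b, IsOnFace (m + t • l) f a ∧ IsOnFace (m + t • l) f b ∧ a ≠ b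
  · obtain ⟨a, b, ha, hb, hab⟩ := hface
    have happ : ∀ z, (m + t • l) z = m z + t * l z := fun z => rfl
    have hld : l (b - a) ≠ 0 := by
      rw [map_sub, sub_ne_zero]
      exact fun h => hab (hl b hb.1 a ha.1 h).symm
    have hline : ∀ c, IsOnFace (m + t • l) f c → c - a ∈ proportionalSubgroup l (b - a) := by
      intro c hc
      refine hm a ha.1 b hb.1 c hc.1 ?_
      have h1 := hb.eq ha
      have h2 := hc.eq ha
      rw [happ, happ] at h1 h2
      simp only [map_sub]
      linear_combination (l b - l a) * h2 - (l c - l a) * h1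
    obtain ⟨e, he, hle⟩ := hG.exists_pos_le_abs l (proportionalSubgroup l (b - a)) fun x hx hlx => by
      by_contra hx0
      obtain ⟨κ, hκ⟩ := exists_addMonoidHom_rat_ne_zero hx0
      have := hx κ
      rw [hlx, zero_mul] at this
      exact (mul_ne_zero hld hκ) this
    refine ⟨e, he, fun g hgf hpos => ?_⟩
    have hg : g ≠ 0 := ne_zero_of_dvd_ne_zero hf hgf
    obtain ⟨p, q, hp, hq, hpq⟩ := exists_faceWidth_eq (m + t • l) l hg
    have hmem : p - q ∈ proportionalSubgroup l (b - a) := by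
      intro κ
      have hzero := IsOnFace.map_sub_eq_zero_of_dvd (l (b - a) • κ - κ (b - a) • l) hf
        (fun x y hx hy => by
          have h1 := hline x hx κ
          have h2 := hline y hy κ
          simp only [AddMonoidHom.sub_apply, AddMonoidHom.coe_smul, Pi.smul_apply, smul_eq_mul,
            map_sub] at h1 h2 ⊢
          linear_combination h1 - h2) hgf hp hq
      simp only [AddMonoidHom.sub_apply, AddMonoidHom.coe_smul, Pi.smul_apply, smul_eq_mul] at hzero
      linear_combination hzero
    have := hle _ hmem fun h => by simp [hpq, h] at hpos
    rwa [← hpq, abs_of_pos hpos] at this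
  · refine ⟨1, one_pos, fun g hgf hpos => ?_⟩
    obtain ⟨a, b, ha, hb, hab⟩ := exists_faceWidth_eq (m + t • l) l hf
    have hEq : a = b := by
      by_contra h
      exact hface ⟨a, b, ha, hb, h⟩
    have h0 := faceWidth_le_of_dvd (m + t • l) l hf hgf
    rw [hab, hEq, sub_self, map_zero] at h0
    exact absurd hpos (not_lt.2 h0)

/-- The divisors of `f` carry an additive length, bounded away from zero on non-units. -/
theorem exists_length_function [IsAddTorsionFree G] (hG : SatisfiesACCOnCyclicSubgroups G)
    {f : K[G]} (hf : f ≠ 0) :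
    ∃ (L : K[G] → ℚ) (e : ℚ), 0 < e ∧ (∀ g h, g ≠ 0 → h ≠ 0 → L (g * h) = L g + L h) ∧
      (∀ g, g ≠ 0 → 0 ≤ L g) ∧ ∀ g, g ∣ f → ¬ IsUnit g → e ≤ L g := by
  classical
  obtain ⟨l, m, hl, hm⟩ := exists_generic_functionals f.coeff.support
  choose e he hle using exists_pos_le_faceWidth_of_dvd hG hf l m hl hm
  -- These are the only slopes at which `f`, and so any divisor of `f`, can have an edge of positive
  -- width. The length is the sum of the widths over them.
  let T : Finset ℚ := (f.coeff.support ×ˢ f.coeff.support).image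
    fun p => (m p.1 - m p.2) / (l p.2 - l p.1)
  obtain ⟨E, hE, hEle⟩ : ∃ E : ℚ, 0 < E ∧ ∀ t ∈ T, E ≤ e t := by
    induction T using Finset.induction_on with
    | empty => exact ⟨1, one_pos, by simp⟩
    | insert t T _ ih =>
      obtain ⟨E, hE, h⟩ := ih
      refine ⟨min E (e t), lt_min hE (he t), fun s hs => ?_⟩
      rcases Finset.mem_insert.1 hs with rfl | hs
      · exact min_le_right _ _
      · exact (min_le_left _ _).trans (h s hs)
  refine ⟨fun g => ∑ t ∈ T, faceWidth (m + t • l) l g, E, hE, fun g h hg hh => ?_,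
    fun g hg => Finset.sum_nonneg fun t _ => faceWidth_nonneg _ _ hg, fun g hgf hu => ?_⟩
  · simp only [faceWidth_mul _ _ hg hh, Finset.sum_add_distrib]
  have hg : g ≠ 0 := ne_zero_of_dvd_ne_zero hf hgf
  -- If `l` were constant on `g`, the whole support of `g` would be its `l`-face. The `l`-face of
  -- `f` is a single point, so every functional would be constant on the support of `g`, and `g`
  -- would be a unit.
  have hlg : ∃ x ∈ g.coeff.support, ∃ y ∈ g.coeff.support, l x ≠ l y := by
    by_contra! hcon
    obtain ⟨x, hx, y, hy, hxy⟩ := exists_ne_mem_support_of_not_isUnit hg hu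
    obtain ⟨κ, hκ⟩ := exists_addMonoidHom_rat_ne_zero (sub_ne_zero.2 hxy)
    exact hκ (IsOnFace.map_sub_eq_zero_of_dvd κ hf
      (fun a b ha hb => by rw [hl a ha.1 b hb.1 (ha.eq hb), sub_self, map_zero]) hgf
      (ν := l) ⟨hx, fun z hz => (hcon z hz x hx).le⟩ ⟨hy, fun z hz => (hcon z hz y hy).le⟩)
  obtain ⟨t, ht⟩ := exists_pos_faceWidth_pencil l m hlg
  have htT : t ∈ T := by
    obtain ⟨a, b, ha, hb, hab⟩ := exists_faceWidth_eq (m + t • l) l hf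
    have h1 := ha.eq hb
    have h2 := ht.trans_le (faceWidth_le_of_dvd (m + t • l) l hf hgf)
    rw [hab, map_sub] at h2
    refine Finset.mem_image.2 ⟨(a, b), Finset.mem_product.2 ⟨ha.1, hb.1⟩, ?_⟩
    change m a + t * l a = m b + t * l b at h1
    rw [div_eq_iff (by linarith)]
    linear_combination h1
  calc E ≤ e t := hEle t htT
    _ ≤ faceWidth (m + t • l) l g := hle t g hgf ht
    _ ≤ _ := Finset.single_le_sum (f := fun t => faceWidth (m + t • l) l g)
      (fun t _ => faceWidth_nonneg _ _ hg) htT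

theorem wfDvdMonoid_addMonoidAlgebra [IsAddTorsionFree G] (hG : SatisfiesACCOnCyclicSubgroups G) :
    WfDvdMonoid K[G] := by
  have hacc : ∀ f : K[G], f ≠ 0 → Acc DvdNotUnit f := by
    intro f hf
    obtain ⟨L, e, he, hmul, hnonneg, hle⟩ := exists_length_function hG hf
    -- Removing a non-unit factor lowers `L` by at least `e`, while `L` stays nonnegative.
    have key : ∀ n : ℕ, ∀ g, g ∣ f → L g < n * e → Acc DvdNotUnit g := by
      intro n
      induction n with
      | zero =>
        intro g hgf hlt
        have := hnonneg g (ne_zero_of_dvd_ne_zero hf hgf)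
        simp only [Nat.cast_zero, zero_mul] at hlt
        linarith
      | succ n ih =>
        intro g hgf hlt
        refine Acc.intro _ ?_
        rintro h ⟨hh, x, hx, rfl⟩
        have hx0 : x ≠ 0 := right_ne_zero_of_mul (ne_zero_of_dvd_ne_zero hf hgf)
        refine ih h ((dvd_mul_right h x).trans hgf) ?_
        have h1 := hle x ((dvd_mul_left x h).trans hgf) hx
        rw [hmul h x hh hx0] at hlt
        push_cast at hlt
        linarith
    obtain ⟨n, hn⟩ := exists_nat_gt (L f / e)
    exact key n f dvd_rfl ((div_lt_iff₀ he).1 hn)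
  refine ⟨⟨fun f => ?_⟩⟩
  by_cases hf : f = 0
  · exact Acc.intro _ fun g hg => hacc g hg.1
  · exact hacc f hf

theorem uniqueFactorizationMonoid_addMonoidAlgebra [IsAddTorsionFree G]
    (hG : SatisfiesACCOnCyclicSubgroups G) : UniqueFactorizationMonoid K[G] :=
  have := wfDvdMonoid_addMonoidAlgebra (K := K) hG
  { irreducible_iff_prime := ⟨prime_of_irreducible_addMonoidAlgebra, Prime.irreducible⟩ }

end Factorial

/-! ### Quotient groups -/

theorem exists_eq_of_sub_of {S : Type*} [AddCommMonoid S] (g : GrothendieckAddGroup S) :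
    ∃ a b : S, g = GrothendieckAddGroup.of a - GrothendieckAddGroup.of b := by
  obtain ⟨⟨a, b⟩, h⟩ := (AddLocalization.addMonoidOf (⊤ : AddSubmonoid S)).surj g
  exact ⟨a, b, eq_sub_of_add_eq h⟩

instance isAddTorsionFree_grothendieckAddGroup (S : Type*) [AddCancelCommMonoid S]
    [IsAddTorsionFree S] : IsAddTorsionFree (GrothendieckAddGroup S) := by
  refine ⟨fun n hn x y h => ?_⟩
  obtain ⟨a, b, rfl⟩ := exists_eq_of_sub_of x
  obtain ⟨c, d, rfl⟩ := exists_eq_of_sub_of y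
  have h : n • (GrothendieckAddGroup.of a - GrothendieckAddGroup.of b) =
    n • (GrothendieckAddGroup.of c - GrothendieckAddGroup.of d) := h
  rw [sub_eq_sub_iff_add_eq_add, ← map_add, ← map_add]
  congr 1
  refine IsAddTorsionFree.nsmul_right_injective hn
    (GrothendieckAddGroup.of_injective (M := S) ?_)
  simp only [map_nsmul, map_add]
  rw [smul_sub, smul_sub, sub_eq_sub_iff_add_eq_add] at h
  rw [smul_add, smul_add, h]

/-! ### Prime ideals of monoids and of monoid algebras -/

section Monoid

variable {K S : Type*} [Field K] [AddCancelCommMonoid S]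

theorem IsPrimeMonoidIdeal.notMem_of_isAddUnit {P : AddSemigroupIdeal S}
    (hP : IsPrimeMonoidIdeal P) {s : S} (hs : IsAddUnit s) : s ∉ P := by
  intro hsP
  obtain ⟨t, ht⟩ := hs.exists_neg
  refine hP.ne_univ (Set.eq_univ_of_forall fun x => ?_)
  have : x + t + s ∈ P := AddSemigroupIdeal.add_mem P _ hsP
  rwa [add_assoc, add_comm t s, ht, add_zero] at this

theorem IsPrimeMonoidIdeal.zero_notMem {P : AddSemigroupIdeal S} (hP : IsPrimeMonoidIdeal P) :
    (0 : S) ∉ P := hP.notMem_of_isAddUnit isAddUnit_zero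

theorem IsPrimeMonoidIdeal.add_notMem {P : AddSemigroupIdeal S} (hP : IsPrimeMonoidIdeal P)
    {a b : S} (ha : a ∉ P) (hb : b ∉ P) : a + b ∉ P :=
  fun h => (hP.mem_or_mem a b h).elim ha hb

theorem IsWeaklyKrullMonoid.finite_setOf_mem (hS : IsWeaklyKrullMonoid S) (s : S) :
    {P ∈ monoidHeightOneSpectrum S | s ∈ P}.Finite := by
  by_cases hs : IsAddUnit s
  · refine Set.Finite.subset Set.finite_empty ?_
    rintro P ⟨hP, hsP⟩
    exact hP.1.1.notMem_of_isAddUnit hs hsP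
  · exact hS.finite_character s hs

theorem mem_monoidAlgebraIdeal {P : AddSemigroupIdeal S} {f : K[S]} :
    f ∈ monoidAlgebraIdeal K P ↔ ∀ s ∈ f.coeff.support, s ∈ P := Iff.rfl

theorem single_mem_monoidAlgebraIdeal {P : AddSemigroupIdeal S} {s : S} :
    (AddMonoidAlgebra.single s 1 : K[S]) ∈ monoidAlgebraIdeal K P ↔ s ∈ P := by
  rw [mem_monoidAlgebraIdeal, AddMonoidAlgebra.coeff_single,
    Finsupp.support_single _ one_ne_zero]
  simp

theorem monoidAlgebraIdeal_le_iff {P : AddSemigroupIdeal S} {I : Ideal K[S]} :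
    monoidAlgebraIdeal K P ≤ I ↔ ∀ s ∈ P, (AddMonoidAlgebra.single s 1 : K[S]) ∈ I := by
  classical
  refine ⟨fun h s hs => h (single_mem_monoidAlgebraIdeal.2 hs), fun h f hf => ?_⟩
  have hsum : f = ∑ s ∈ f.coeff.support,
      AddMonoidAlgebra.single 0 (f.coeff s) * AddMonoidAlgebra.single s 1 := by
    ext x
    simp only [AddMonoidAlgebra.single_mul_single, zero_add, mul_one, AddMonoidAlgebra.coeff_sum,
      AddMonoidAlgebra.coeff_single, Finsupp.finsetSum_apply, Finsupp.single_apply]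
    simp
  rw [hsum]
  exact I.sum_mem fun s hs => I.mul_mem_left _ (h s (hf s hs))

theorem monoidAlgebraIdeal_injective :
    Function.Injective (monoidAlgebraIdeal K : AddSemigroupIdeal S → Ideal K[S]) := by
  intro P Q h
  ext s
  rw [← single_mem_monoidAlgebraIdeal (K := K), h, single_mem_monoidAlgebraIdeal]

theorem exists_add_eq_of_single_dvd {a b : S}
    (h : (AddMonoidAlgebra.single b 1 : K[S]) ∣ AddMonoidAlgebra.single a 1) :
    ∃ c, b + c = a := by
  classical
  obtain ⟨f, hf⟩ := h
  have ha : a ∈ (AddMonoidAlgebra.single b 1 * f : K[S]).coeff.support := by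
    rw [← hf]
    simp
  obtain ⟨b', hb', c, -, hc⟩ := Finset.mem_add.1 (AddMonoidAlgebra.support_coeff_mul_subset _ _ ha)
  rw [AddMonoidAlgebra.coeff_single, Finsupp.support_single _ one_ne_zero,
    Finset.mem_singleton] at hb'
  exact ⟨c, hb' ▸ hc⟩

theorem isAddUnit_of_isUnit_single {s : S}
    (h : IsUnit (AddMonoidAlgebra.single s 1 : K[S])) : IsAddUnit s := by
  obtain ⟨c, hc⟩ := exists_add_eq_of_single_dvd (K := K) (a := 0) (h.dvd)
  exact IsAddUnit.of_add_eq_zero c hc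

/-- Among the exponents outside `P` of two elements not in `K[P]` there is a unique sum. It stays
outside `P`, and exponents in `P` cannot contribute to it, so it survives in the product. -/
theorem monoidAlgebraIdeal_isPrime [IsAddTorsionFree S] {P : AddSemigroupIdeal S}
    (hP : IsPrimeMonoidIdeal P) : (monoidAlgebraIdeal K P).IsPrime := by
  classical
  refine Ideal.isPrime_iff.2 ⟨fun h => hP.zero_notMem ?_, fun {f g} hfg => ?_⟩
  · rw [← single_mem_monoidAlgebraIdeal (K := K), h]
    exact Submodule.mem_top
  · by_contra! hcon
    simp only [mem_monoidAlgebraIdeal, not_forall] at hcon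
    obtain ⟨⟨x, hx, hxP⟩, y, hy, hyP⟩ := hcon
    obtain ⟨a, ha, b, hb, hab⟩ := UniqueSums.uniqueAdd_of_nonempty
      (A := f.coeff.support.filter (· ∉ P)) (B := g.coeff.support.filter (· ∉ P))
      ⟨x, Finset.mem_filter.2 ⟨hx, hxP⟩⟩ ⟨y, Finset.mem_filter.2 ⟨hy, hyP⟩⟩
    obtain ⟨haf, haP⟩ := Finset.mem_filter.1 ha
    obtain ⟨hbg, hbP⟩ := Finset.mem_filter.1 hb
    have hnot := hP.add_notMem haP hbP
    have huniq : UniqueAdd f.coeff.support g.coeff.support a b := by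
      intro a' b' ha' hb' h
      refine hab (Finset.mem_filter.2 ⟨ha', fun h' => hnot ?_⟩)
        (Finset.mem_filter.2 ⟨hb', fun h' => hnot ?_⟩) h
      · rw [← h, add_comm]
        exact AddSemigroupIdeal.add_mem P _ h'
      · rw [← h]
        exact AddSemigroupIdeal.add_mem P _ h'
    refine hnot (hfg _ ?_)
    rw [Finsupp.mem_support_iff, AddMonoidAlgebra.coeff_mul_add_of_uniqueAdd huniq]
    exact mul_ne_zero (Finsupp.mem_support_iff.1 haf) (Finsupp.mem_support_iff.1 hbg)

theorem monoidAlgebraIdeal_ne_bot {P : AddSemigroupIdeal S} {s : S} (hs : s ∈ P) :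
    monoidAlgebraIdeal K P ≠ ⊥ := by
  intro h
  have := (single_mem_monoidAlgebraIdeal (K := K)).2 hs
  rw [h, Ideal.mem_bot] at this
  exact one_ne_zero (AddMonoidAlgebra.single_right_injective
    (this.trans (AddMonoidAlgebra.single_zero s).symm))

/-- The exponents of the monomials in an ideal of `K[S]`. -/
def monomialIdeal (I : Ideal K[S]) : AddSemigroupIdeal S where
  carrier := {s | (AddMonoidAlgebra.single s 1 : K[S]) ∈ I}
  vadd_mem' a s hs := by
    have : (AddMonoidAlgebra.single (a + s) 1 : K[S]) =
        AddMonoidAlgebra.single a 1 * AddMonoidAlgebra.single s 1 := by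
      rw [AddMonoidAlgebra.single_mul_single, mul_one]
    change (AddMonoidAlgebra.single (a + s) 1 : K[S]) ∈ I
    rw [this]
    exact I.mul_mem_left _ hs

theorem mem_monomialIdeal {I : Ideal K[S]} {s : S} :
    s ∈ monomialIdeal I ↔ (AddMonoidAlgebra.single s 1 : K[S]) ∈ I := Iff.rfl

theorem isPrimeMonoidIdeal_monomialIdeal {I : Ideal K[S]} (hI : I.IsPrime) :
    IsPrimeMonoidIdeal (monomialIdeal I) := by
  refine ⟨fun h => ?_, fun a b hab => ?_⟩
  · have : (0 : S) ∈ (monomialIdeal I : Set S) := by rw [h]; trivial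
    exact hI.ne_top ((Ideal.eq_top_iff_one I).2 this)
  · rw [mem_monomialIdeal, ← mul_one (1 : K), ← AddMonoidAlgebra.single_mul_single] at hab
    exact hI.mem_or_mem hab

/-- A height-one prime of `K[S]` that contains a monomial is `K[P]` for some `P ∈ 𝔛(S)`. -/
theorem exists_eq_monoidAlgebraIdeal [IsAddTorsionFree S] {Q : Ideal K[S]}
    (hQ : Q ∈ heightOneSpectrum K[S]) {s : S} (hs : (AddMonoidAlgebra.single s 1 : K[S]) ∈ Q) :
    ∃ P ∈ monoidHeightOneSpectrum S, Q = monoidAlgebraIdeal K P := by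
  obtain ⟨hQp, -, hmin⟩ := mem_heightOneSpectrum_iff.1 hQ
  have hP := isPrimeMonoidIdeal_monomialIdeal hQp
  -- Applied to the monomial ideal of `Q` itself this identifies `Q`; applied to smaller primes it
  -- gives minimality.
  have hle : ∀ P : AddSemigroupIdeal S, IsPrimeMonoidIdeal P → (P : Set S).Nonempty →
      P ≤ monomialIdeal Q → monoidAlgebraIdeal K P = Q := fun P hP' hne hle =>
    hmin _ (monoidAlgebraIdeal_isPrime hP') (monoidAlgebraIdeal_ne_bot hne.some_mem)
      (monoidAlgebraIdeal_le_iff.2 fun s hs => hle hs)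
  have hEq := hle _ hP ⟨s, hs⟩ le_rfl
  refine ⟨monomialIdeal Q, ⟨⟨hP, s, hs⟩, fun P' hP' hP'le => ?_⟩, hEq.symm⟩
  exact (monoidAlgebraIdeal_injective ((hle P' hP'.1 hP'.2 hP'le).trans hEq.symm)).ge

end Monoid

/-! ### Monoid algebras and group algebras -/

section Localization

variable {K S : Type*} [Field K] [AddCancelCommMonoid S]

variable (K S) in
/-- The inclusion of `K[S]` in the group algebra of the quotient group of `S`. -/
noncomputable abbrev toGroupAlgebra : K[S] →+* K[GrothendieckAddGroup S] :=
  AddMonoidAlgebra.mapDomainRingHom K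
    (GrothendieckAddGroup.of : S →+ GrothendieckAddGroup S)

theorem toGroupAlgebra_injective : Function.Injective (toGroupAlgebra K S) :=
  mapDomainRingHom_injective GrothendieckAddGroup.of_injective

theorem coeff_toGroupAlgebra (f : K[S]) (s : S) :
    (toGroupAlgebra K S f).coeff (GrothendieckAddGroup.of s) = f.coeff s :=
  Finsupp.mapDomain_apply GrothendieckAddGroup.of_injective _ _

theorem exists_of_mem_support_toGroupAlgebra {f : K[S]} {g : GrothendieckAddGroup S}
    (hg : g ∈ (toGroupAlgebra K S f).coeff.support) :
    ∃ s ∈ f.coeff.support, GrothendieckAddGroup.of s = g := by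
  classical
  exact Finset.mem_image.1 (Finsupp.mapDomain_support hg)

theorem of_mem_support_toGroupAlgebra {f : K[S]} {s : S} (hs : s ∈ f.coeff.support) :
    GrothendieckAddGroup.of s ∈ (toGroupAlgebra K S f).coeff.support := by
  rw [Finsupp.mem_support_iff, coeff_toGroupAlgebra]
  exact Finsupp.mem_support_iff.1 hs

theorem exists_toGroupAlgebra_eq {f : K[GrothendieckAddGroup S]}
    (hf : ∀ g ∈ f.coeff.support,
      g ∈ Set.range (GrothendieckAddGroup.of : S →+ GrothendieckAddGroup S)) :
    ∃ h : K[S], toGroupAlgebra K S h = f :=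
  ⟨_, AddMonoidAlgebra.mapDomain_comapDomain hf GrothendieckAddGroup.of_injective⟩

theorem isLocalization_toGroupAlgebra :
    letI := (toGroupAlgebra K S).toAlgebra
    IsLocalization (MonoidHom.mrange (AddMonoidAlgebra.of K S)) K[GrothendieckAddGroup S] :=
  isLocalization_mapDomainRingHom _ GrothendieckAddGroup.of_injective exists_eq_of_sub_of

theorem comap_mem_heightOneSpectrum {Q : Ideal K[GrothendieckAddGroup S]}
    (hQ : Q ∈ heightOneSpectrum K[GrothendieckAddGroup S]) :
    Q.comap (toGroupAlgebra K S) ∈ heightOneSpectrum K[S] := by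
  let _ := (toGroupAlgebra K S).toAlgebra
  have := isLocalization_toGroupAlgebra (K := K) (S := S)
  have hQp := hQ.1
  exact ⟨Ideal.comap_isPrime _ _,
    (IsLocalization.height_under (MonoidHom.mrange (AddMonoidAlgebra.of K S)) Q).trans hQ.2⟩

theorem exists_eq_comap_toGroupAlgebra {Q : Ideal K[S]} (hQ : Q ∈ heightOneSpectrum K[S])
    (hs : ∀ s, (AddMonoidAlgebra.single s 1 : K[S]) ∉ Q) :
    ∃ Q' ∈ heightOneSpectrum K[GrothendieckAddGroup S], Q = Q'.comap (toGroupAlgebra K S) := by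
  let _ := (toGroupAlgebra K S).toAlgebra
  have := isLocalization_toGroupAlgebra (K := K) (S := S)
  have hd : Disjoint (MonoidHom.mrange (AddMonoidAlgebra.of K S) : Set K[S]) Q := by
    rw [Set.disjoint_left]
    rintro _ ⟨s, rfl⟩
    exact hs s.toAdd
  have hQp := hQ.1
  have hunder := IsLocalization.under_map_of_isPrime_disjoint
    (MonoidHom.mrange (AddMonoidAlgebra.of K S)) K[GrothendieckAddGroup S] hQp hd
  refine ⟨Q.map (toGroupAlgebra K S), ⟨IsLocalization.isPrime_of_isPrime_disjoint
    (MonoidHom.mrange (AddMonoidAlgebra.of K S)) K[GrothendieckAddGroup S] Q hQp hd, ?_⟩,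
    hunder.symm⟩
  exact (IsLocalization.height_map_of_disjoint
    (MonoidHom.mrange (AddMonoidAlgebra.of K S)) Q hd).trans hQ.2

theorem zero_mem_monoidLocalization {P : AddSemigroupIdeal S} (hP : IsPrimeMonoidIdeal P) :
    (0 : GrothendieckAddGroup S) ∈ monoidLocalization P :=
  ⟨0, 0, hP.zero_notMem, by simp⟩

theorem of_mem_monoidLocalization {P : AddSemigroupIdeal S} (hP : IsPrimeMonoidIdeal P) (a : S) :
    GrothendieckAddGroup.of a ∈ monoidLocalization P :=
  ⟨a, 0, hP.zero_notMem, by simp⟩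

theorem neg_of_mem_monoidLocalization {P : AddSemigroupIdeal S} {b : S} (hb : b ∉ P) :
    -GrothendieckAddGroup.of b ∈ monoidLocalization P :=
  ⟨0, b, hb, by simp⟩

theorem add_mem_monoidLocalization {P : AddSemigroupIdeal S} (hP : IsPrimeMonoidIdeal P)
    {x y : GrothendieckAddGroup S} (hx : x ∈ monoidLocalization P)
    (hy : y ∈ monoidLocalization P) : x + y ∈ monoidLocalization P := by
  obtain ⟨a, b, hb, rfl⟩ := hx
  obtain ⟨c, d, hd, rfl⟩ := hy
  exact ⟨a + c, b + d, hP.add_notMem hb hd, by simp only [map_add]; abel⟩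

theorem notMem_of_neg_of_mem_monoidLocalization {P : AddSemigroupIdeal S}
    {a : S} (ha : -GrothendieckAddGroup.of a ∈ monoidLocalization P) : a ∉ P := by
  obtain ⟨c, b, hb, h⟩ := ha
  intro haP
  have hEq : b = c + a := GrothendieckAddGroup.of_injective (by
    rw [map_add]
    rw [neg_eq_iff_eq_neg.1 h]
    abel)
  exact hb (hEq ▸ AddSemigroupIdeal.add_mem P _ haP)

/-- If `w c ∈ K[S]` with `w ∈ K[S]` outside `K[P]`, then all exponents of `c` lie in `S_P`. -/
theorem mem_monoidLocalization_of_mul_eq [IsAddTorsionFree S] {P : AddSemigroupIdeal S}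
    (hP : IsPrimeMonoidIdeal P) {w h : K[S]} (hw : w ∉ monoidAlgebraIdeal K P)
    {c : K[GrothendieckAddGroup S]} (hc : toGroupAlgebra K S w * c = toGroupAlgebra K S h)
    {g : GrothendieckAddGroup S} (hg : g ∈ c.coeff.support) : g ∈ monoidLocalization P := by
  classical
  by_contra hgP
  -- Divisibility in `S_P`, whose equivalence classes are the cosets of its units. Take `x₀` minimal
  -- among the exponents of `c` outside `S_P`, and let `E` be its class within the support of `c`.
  let _ : Preorder (GrothendieckAddGroup S) :=
    { le := fun x y => y - x ∈ monoidLocalization P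
      le_refl := fun x => by rw [sub_self]; exact zero_mem_monoidLocalization hP
      le_trans := fun x y z hxy hyz => by
        have := add_mem_monoidLocalization hP hyz hxy
        rwa [sub_add_sub_cancel] at this }
  have hle : ∀ x y : GrothendieckAddGroup S, x ≤ y ↔ y - x ∈ monoidLocalization P :=
    fun _ _ => Iff.rfl
  obtain ⟨x₀, hx₀, hmin⟩ := (c.coeff.support.filter (· ∉ monoidLocalization P)).exists_minimal
    ⟨g, Finset.mem_filter.2 ⟨hg, hgP⟩⟩
  obtain ⟨hx₀c, hx₀P⟩ := Finset.mem_filter.1 hx₀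
  simp only [mem_monoidAlgebraIdeal, not_forall] at hw
  obtain ⟨s, hs, hsP⟩ := hw
  let A := (w.coeff.support.filter (· ∉ P)).image
    (GrothendieckAddGroup.of : S →+ GrothendieckAddGroup S)
  let E := c.coeff.support.filter fun x => x ≤ x₀ ∧ x₀ ≤ x
  obtain ⟨a, ha, x, hx, huniq⟩ := UniqueSums.uniqueAdd_of_nonempty (A := A) (B := E)
    ⟨_, Finset.mem_image_of_mem _ (Finset.mem_filter.2 ⟨hs, hsP⟩)⟩
    ⟨x₀, Finset.mem_filter.2 ⟨hx₀c, le_rfl, le_rfl⟩⟩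
  obtain ⟨a, ha', rfl⟩ := Finset.mem_image.1 ha
  obtain ⟨haw, haP⟩ := Finset.mem_filter.1 ha'
  obtain ⟨hxc, hxx₀, hx₀x⟩ := Finset.mem_filter.1 hx
  have hxP : x ∉ monoidLocalization P := fun hxP => hx₀P (by
    have := add_mem_monoidLocalization hP ((hle _ _).1 hxx₀) hxP
    rwa [sub_add_cancel] at this)
  have hsumP : GrothendieckAddGroup.of a + x ∉ monoidLocalization P := fun hsum => hxP (by
    have := add_mem_monoidLocalization hP (neg_of_mem_monoidLocalization haP) hsum
    rwa [neg_add_cancel_left] at this)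
  -- The exponents of `w` outside `P` are units of `S_P`. Any other representation `a' + x'` of the
  -- sum would have `x' ≤ x` outside `S_P`, hence equivalent to `x₀` by minimality, and then `a' ∉
  -- P`. So uniqueness on `A` and `E` is uniqueness on the full supports.
  have huniq' : UniqueAdd (toGroupAlgebra K S w).coeff.support c.coeff.support
      (GrothendieckAddGroup.of a) x := by
    intro a' x' ha' hx' hEq
    obtain ⟨a', ha'w, rfl⟩ := exists_of_mem_support_toGroupAlgebra ha'
    have hx'P : x' ∉ monoidLocalization P := fun hx'P => hsumP (by
      rw [← hEq]
      exact add_mem_monoidLocalization hP (of_mem_monoidLocalization hP a') hx'P)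
    have hx'x : x' ≤ x := by
      rw [hle]
      have := add_mem_monoidLocalization hP (of_mem_monoidLocalization hP a')
        (neg_of_mem_monoidLocalization haP)
      rwa [show GrothendieckAddGroup.of a' + -GrothendieckAddGroup.of a = x - x' by
        rw [eq_neg_add_of_add_eq hEq]; abel] at this
    have hx₀x' : x₀ ≤ x' := hmin (Finset.mem_filter.2 ⟨hx', hx'P⟩) (hx'x.trans hxx₀)
    have ha'P : a' ∉ P := by
      refine notMem_of_neg_of_mem_monoidLocalization ?_
      have := add_mem_monoidLocalization hP (neg_of_mem_monoidLocalization haP)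
        ((hle _ _).1 (hxx₀.trans hx₀x'))
      rwa [show -GrothendieckAddGroup.of a + (x' - x) = -GrothendieckAddGroup.of a' by
        rw [eq_neg_add_of_add_eq hEq]; abel] at this
    exact huniq (Finset.mem_image_of_mem _ (Finset.mem_filter.2 ⟨ha'w, ha'P⟩))
      (Finset.mem_filter.2 ⟨hx', hx'x.trans hxx₀, hx₀x'⟩) hEq
  have hmem : GrothendieckAddGroup.of a + x ∈ (toGroupAlgebra K S h).coeff.support := by
    rw [← hc, Finsupp.mem_support_iff, AddMonoidAlgebra.coeff_mul_add_of_uniqueAdd huniq']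
    exact mul_ne_zero (Finsupp.mem_support_iff.1 (of_mem_support_toGroupAlgebra haw))
      (Finsupp.mem_support_iff.1 hxc)
  obtain ⟨s, -, hs⟩ := exists_of_mem_support_toGroupAlgebra hmem
  exact hsumP (hs ▸ of_mem_monoidLocalization hP s)

end Localization

/-! ### Weakly Krull monoid algebras -/

section Main

variable {K S : Type*} [Field K] [AddCancelCommMonoid S] [IsAddTorsionFree S]

theorem isWeaklyKrullDomain_monoidAlgebra
    (hG : SatisfiesACCOnCyclicSubgroups (GrothendieckAddGroup S))
    (hS : IsWeaklyKrullMonoid S) (hU : IsUMTOver K S) : IsWeaklyKrullDomain K[S] := by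
  have := uniqueFactorizationMonoid_addMonoidAlgebra (K := K) hG
  refine ⟨iInf_localization_eq_bot_iff.2 fun a b hb h => ?_, fun f hf _ => ?_⟩
  · have hb' : toGroupAlgebra K S b ≠ 0 := (map_ne_zero_iff _ toGroupAlgebra_injective).2 hb
    -- Each prime `p` of the factorial ring `K[G]` contracts to a height-one prime of `K[S]`, where
    -- the local hypothesis applies.
    obtain ⟨c, hc⟩ : toGroupAlgebra K S b ∣ toGroupAlgebra K S a := by
      refine dvd_of_forall_prime_exists_dvd_mul hb' fun p hp => ?_
      obtain ⟨s, hs, hdvd⟩ := h _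
        (comap_mem_heightOneSpectrum (span_singleton_mem_heightOneSpectrum hp))
      rw [Ideal.mem_comap, Ideal.mem_span_singleton] at hs
      exact ⟨_, hs, by rw [← map_mul]; exact map_dvd _ hdvd⟩
    have hexp : ∀ g ∈ c.coeff.support,
        g ∈ Set.range (GrothendieckAddGroup.of : S →+ GrothendieckAddGroup S) := by
      intro g hg
      rw [← hS.iInter_localization_eq_range]
      refine Set.mem_iInter₂.2 fun P hP => ?_
      have hmem : monoidAlgebraIdeal K P ∈ heightOneSpectrum K[S] := by
        rw [hU]
        exact Or.inl ⟨P, hP, rfl⟩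
      obtain ⟨s, hs, r, hr⟩ := h _ hmem
      have hsc : toGroupAlgebra K S s * c = toGroupAlgebra K S r := by
        refine mul_left_cancel₀ hb' ?_
        have h1 := congrArg (toGroupAlgebra K S) hr
        rw [map_mul, map_mul, hc] at h1
        linear_combination h1
      exact mem_monoidLocalization_of_mul_eq hP.1.1 hs hsc hg
    obtain ⟨d, rfl⟩ := exists_toGroupAlgebra_eq hexp
    have hbd := map_mul (toGroupAlgebra K S) b d
    exact ⟨d, toGroupAlgebra_injective (hc.trans hbd.symm)⟩
  · obtain ⟨s, hs⟩ := support_nonempty_of_ne_zero hf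
    have hf' : toGroupAlgebra K S f ≠ 0 := (map_ne_zero_iff _ toGroupAlgebra_injective).2 hf
    refine (((hS.finite_setOf_mem s).image (monoidAlgebraIdeal K)).union
      ((finite_heightOneSpectrum_of_ne_zero hf').image
        (Ideal.comap (toGroupAlgebra K S)))).subset ?_
    rintro Q ⟨hQ, hfQ⟩
    rw [hU] at hQ
    rcases hQ with ⟨P, hP, rfl⟩ | ⟨Q', hQ', rfl⟩
    · exact Or.inl ⟨P, ⟨hP, hfQ s hs⟩, rfl⟩
    · exact Or.inr ⟨Q', ⟨hQ', hfQ⟩, rfl⟩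

/-- For a monomial `x ∈ K[P]`, it suffices to find a height-one prime through `x` inside `K[P]`: it
has the form `K[P']` with `P' ⊆ P`, and minimality gives `P' = P`. -/
theorem IsWeaklyKrullDomain.monoidAlgebraIdeal_mem_heightOneSpectrum
    (h : IsWeaklyKrullDomain K[S]) {P : AddSemigroupIdeal S} (hP : P ∈ monoidHeightOneSpectrum S) :
    monoidAlgebraIdeal K P ∈ heightOneSpectrum K[S] := by
  classical
  obtain ⟨s, hs⟩ := hP.1.2
  have hprime := monoidAlgebraIdeal_isPrime (K := K) hP.1.1
  let x : K[S] := AddMonoidAlgebra.single s 1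
  have hxP : x ∈ monoidAlgebraIdeal K P := single_mem_monoidAlgebraIdeal.2 hs
  have hx0 : x ≠ 0 := fun h0 => one_ne_zero (AddMonoidAlgebra.single_right_injective
    (h0.trans (AddMonoidAlgebra.single_zero s).symm))
  have hfin := h.finite_character x hx0 fun hu =>
    hprime.ne_top (Ideal.eq_top_of_isUnit_mem _ hxP hu)
  obtain ⟨Q, hQ, hxQ, hQP⟩ : ∃ Q ∈ heightOneSpectrum K[S], x ∈ Q ∧ Q ≤ monoidAlgebraIdeal K P := by
    by_contra! hcon
    have hex : ∀ Q ∈ hfin.toFinset, ∃ y ∈ Q, y ∉ monoidAlgebraIdeal K P := fun Q hQ => by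
      have hQ' : Q ∈ heightOneSpectrum K[S] ∧ x ∈ Q := by simpa using hQ
      exact Set.not_subset.1 (hcon Q hQ'.1 hQ'.2)
    choose! y hyQ hyP using hex
    -- Prime avoidance by a product: `z` lies in every height-one prime through `x` but not in
    -- `K[P]`. Locally `x` divides a power of `z`, with a uniform exponent by finite character, so
    -- `x` divides it globally, and this forces `z ∈ K[P]`.
    let z : K[S] := ∏ Q ∈ hfin.toFinset, y Q
    have hzQ : ∀ Q ∈ hfin.toFinset, z ∈ Q := fun Q hQ =>
      Q.mem_of_dvd (Finset.dvd_prod_of_mem y hQ) (hyQ Q hQ)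
    have hpow : ∀ Q ∈ hfin.toFinset, ∃ (n : ℕ) (t : K[S]), t ∉ Q ∧ x ∣ z ^ n * t := fun Q hQ => by
      have hQ' : Q ∈ heightOneSpectrum K[S] ∧ x ∈ Q := by simpa using hQ
      exact exists_dvd_pow_mul_of_mem_heightOneSpectrum hQ'.1 hx0 (hzQ Q hQ)
    choose! n t htQ hdvd using hpow
    have hxz : x ∣ z ^ (hfin.toFinset.sup n) := by
      refine iInf_localization_eq_bot_iff.1 h.iInf_localization_eq_bot _ _ hx0 fun Q hQ => ?_
      by_cases hxQ : x ∈ Q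
      · have hQm : Q ∈ hfin.toFinset := by simpa using ⟨hQ, hxQ⟩
        exact ⟨t Q, htQ Q hQm, (hdvd Q hQm).trans
          (mul_dvd_mul_right (pow_dvd_pow _ (Finset.le_sup hQm)) _)⟩
      · exact ⟨x, hxQ, dvd_mul_left _ _⟩
    have hzP : z ∈ monoidAlgebraIdeal K P :=
      hprime.mem_of_pow_mem _ (Ideal.mem_of_dvd _ hxz hxP)
    obtain ⟨Q, hQ, hyQP⟩ := (hprime.prod_mem_iff).1 hzP
    exact hyP Q hQ hyQP
  obtain ⟨P', hP', rfl⟩ := exists_eq_monoidAlgebraIdeal hQ hxQ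
  have hle : P' ≤ P := fun s hs => by
    rw [← single_mem_monoidAlgebraIdeal (K := K)]
    exact hQP (single_mem_monoidAlgebraIdeal.2 hs)
  rwa [le_antisymm (hP.2 hP'.1 hle) hle]

theorem IsWeaklyKrullDomain.isUMTOver (h : IsWeaklyKrullDomain K[S]) : IsUMTOver K S := by
  refine Set.Subset.antisymm (fun Q hQ => ?_) ?_
  · by_cases hs : ∃ s, (AddMonoidAlgebra.single s 1 : K[S]) ∈ Q
    · obtain ⟨s, hs⟩ := hs
      exact Or.inl (exists_eq_monoidAlgebraIdeal hQ hs)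
    · exact Or.inr (exists_eq_comap_toGroupAlgebra hQ (not_exists.1 hs))
  · rintro Q (⟨P, hP, rfl⟩ | ⟨Q', hQ', rfl⟩)
    · exact h.monoidAlgebraIdeal_mem_heightOneSpectrum hP
    · exact comap_mem_heightOneSpectrum hQ'

theorem IsWeaklyKrullDomain.isWeaklyKrullMonoid (h : IsWeaklyKrullDomain K[S]) :
    IsWeaklyKrullMonoid S := by
  have hne : ∀ s : S, (AddMonoidAlgebra.single s 1 : K[S]) ≠ 0 := fun s h0 =>
    one_ne_zero (AddMonoidAlgebra.single_right_injective
      (h0.trans (AddMonoidAlgebra.single_zero s).symm))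
  refine ⟨Set.Subset.antisymm (fun g hg => ?_) ?_, fun s hs => ?_⟩
  · obtain ⟨a, b, rfl⟩ := exists_eq_of_sub_of g
    rw [Set.mem_iInter₂] at hg
    -- Only height-one primes containing the monomial of `b` matter for this divisibility, and these
    -- are all of the form `K[P]`, where membership of `a - b` in `S_P` provides the monomial
    -- multiplier.
    have hdvd : (AddMonoidAlgebra.single b 1 : K[S]) ∣ AddMonoidAlgebra.single a 1 := by
      refine iInf_localization_eq_bot_iff.1 h.iInf_localization_eq_bot _ _ (hne b) fun Q hQ => ?_
      by_cases hbQ : (AddMonoidAlgebra.single b 1 : K[S]) ∈ Q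
      · obtain ⟨P, hP, rfl⟩ := exists_eq_monoidAlgebraIdeal hQ hbQ
        obtain ⟨c, d, hd, hcd⟩ := hg P hP
        have hEq : a + d = b + c := GrothendieckAddGroup.of_injective (by
          rw [sub_eq_sub_iff_add_eq_add] at hcd
          rw [map_add, map_add, hcd, add_comm])
        refine ⟨AddMonoidAlgebra.single d 1, fun hd' => hd (single_mem_monoidAlgebraIdeal.1 hd'),
          AddMonoidAlgebra.single c 1, ?_⟩
        rw [AddMonoidAlgebra.single_mul_single, AddMonoidAlgebra.single_mul_single, hEq]
      · exact ⟨_, hbQ, dvd_mul_left _ _⟩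
    obtain ⟨c, rfl⟩ := exists_add_eq_of_single_dvd hdvd
    exact ⟨c, by rw [map_add, add_sub_cancel_left]⟩
  · rintro _ ⟨a, rfl⟩
    exact Set.mem_iInter₂.2 fun P hP => of_mem_monoidLocalization hP.1.1 a
  · refine Set.Finite.of_finite_image (f := monoidAlgebraIdeal K)
      ((h.finite_character _ (hne s) fun hu => hs (isAddUnit_of_isUnit_single hu)).subset ?_)
      monoidAlgebraIdeal_injective.injOn
    rintro _ ⟨P, ⟨hP, hsP⟩, rfl⟩
    exact ⟨h.monoidAlgebraIdeal_mem_heightOneSpectrum hP, single_mem_monoidAlgebraIdeal.2 hsP⟩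

end Main

theorem proposition2p6 (K S : Type*) [Field K] [AddCancelCommMonoid S] [IsAddTorsionFree S]
    (hG : SatisfiesACCOnCyclicSubgroups (GrothendieckAddGroup S)) :
    (IsWeaklyKrullDomain K[S] ↔ IsWeaklyKrullMonoid S ∧ IsUMTOver K S) ∧
    (IsWeaklyKrullMonoid S → IsUMTOver K S →
      ∀ P ∈ monoidHeightOneSpectrum S, IsMaximalTIdeal (monoidAlgebraIdeal K P)) := by
  refine ⟨⟨fun h => ⟨h.isWeaklyKrullMonoid, h.isUMTOver⟩,
    fun h => isWeaklyKrullDomain_monoidAlgebra hG h.1 h.2⟩, fun hS hU P hP => ?_⟩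
  have h := isWeaklyKrullDomain_monoidAlgebra hG hS hU
  exact h.isMaximalTIdeal (h.monoidAlgebraIdeal_mem_heightOneSpectrum hP)
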